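/- Let $K$ be a number field with ring of integers $\mathcal O_K$, $\widehat K=K\otimes_{\mathbb Q}\mathbb R$, and let $\mathfrak n$ be a nonzero ideal of $\mathcal O_K$. A lattice is a finitely generated $\mathcal O_K$-submodule $L\subset\widehat K^2$ with $\widehat K L=\widehat K^2$ and $\dim_K KL=2$; its class $[L]\in\mathrm{Cl}(K)$ is the class of any ideal $\mathfrak a$ with $L\cong\mathcal O_K\oplus\mathfrak a$. For lattices $L\subseteq M$ with $M/L\cong \mathcal O_K/\mathfrak a_1\oplus\mathcal O_K/\mathfrak a_2$, $\mathfrak a_1\mid\mathfrak a_2$, put $[M:L]=\mathfrak a_1\mathfrak a_2$. Let $\mathcal M=\mathcal M_0(\mathfrak n)$ be the set of pairs $(L,L')$ of lattices with $L\subseteq L'$ and $L'/L\cong\mathcal O_K/\mathfrak n$, or let $\mathcal M=\mathcal M_1(\mathfrak n)$ be the set of triples $(L,L',\beta)$, where $(L,L')\in\mathcal M_0(\mathfrak n)$ and $\beta\in L'/L$ is a generator. Write $\mathcal M^{(c)}\subseteq\mathcal M$ for the points with $[L]=c$. The Hecke algebra $\mathbb T$ is the $\mathbb Q$-algebra of operators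 on $\mathbb Q\mathcal M$ generated by the following operators (where $\beta$ is omitted if $\mathcal M=\mathcal M_0(\mathfrak n)$). * For every nonzero ideal $\mathfrak a$ of $\mathcal O_K$, $T_{\mathfrak a}(L,L',\beta)=N(\mathfrak a)^{-1}\sum (M,M+L',\beta)$, the sum being over the lattices $M\supseteq L$ with $[M:L]=\mathfrak a$ and $(M,M+L',\beta)\in\mathcal M$. * For every fractional ideal $\mathfrak a$ coprime to $\mathfrak n$, $T_{\mathfrak a,\mathfrak a}(L,L',\beta)=N(\mathfrak a)^{-2}(\mathfrak a^{-1}L,\mathfrak a^{-1}L',\beta)$, where $\beta$ is represented by a vector in $L'\cap\mathfrak a^{-1}L'$. For $c\in\mathrm{Cl}(K)$ let $\mathbb T_c$ be the space of operators $T\in\mathbb T$ of class $c$, that is, with $T(\mathbb Q\mathcal M^{(c')})\subseteq\mathbb Q\mathcal M^{(cc')}$ for all $c'$. An eigensystem is a ring homomorphism $\lambda:\mathbb T\to\mathbb C$, and $H_0(\lambda)$ is the subgroup of those $c\in\mathrm{Cl}(K)$ for which $\lambda$ is not identically zero on $\mathbb T_c$. For a character $\psi$ of $\mathrm{Cl}(K)$,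 the twist $\lambda\otimes\psi$ is the eigensystem with $T_{\mathfrak a}\mapsto\psi([\mathfrak a])\lambda(T_{\mathfrak a})$ and $T_{\mathfrak a,\mathfrak a}\mapsto\psi([\mathfrak a])^2\lambda(T_{\mathfrak a,\mathfrak a})$. We say that $\lambda$ has an inner twist if $\lambda\otimes\psi=\lambda$ for some character $\psi$ of $\mathrm{Cl}(K)$ with $\psi\ne1$ and $\psi^2=1$. Let $V=\mathbb C\mathcal M$ with $V_c=\mathbb C\mathcal M^{(c)}$, or, more generally, let $V$ be any complex vector space on which $\mathbb T$ acts linearly, with a decomposition $V=\bigoplus_{c\in\mathrm{Cl}(K)}V_c$ such that $T(V_{c'})\subseteq V_{cc'}$ for all $c,c'$ and all $T\in\mathbb T_c$. Let $v=\sum_c v_c\in V$, $v_c\in V_c$, be a simultaneous eigenvector with eigensystem $\lambda$: $v\neq0$ and $T(v)=\lambda(T)v$ for all $T\in\mathbb T$. 1. If $v_{c_1}=0$ for some class $c_1$, then $v_c=0$ for all classes $c$ in the coset $H_0(\lambda)c_1$. 2. If $\lambda$ has no inner twist, then every component $v_c$ of $v$ is nonzero. 3. If the class number of $K$ is odd,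 then no eigensystem has an inner twist, and hence every component $v_c$ of $v$ is nonzero. -/

import Mathlib

open scoped NumberField nonZeroDivisors TensorProduct

noncomputable section

namespace HeckePoints

universe u

variable (K : Type u) [Field K] [NumberField K]

/-- The algebra `K ⊗ ℝ`, a product of copies of `ℝ` and `ℂ`. -/
abbrev KHat : Type u := K ⊗[ℚ] ℝ

/-- Row vectors of length two over `K ⊗ ℝ`. -/
abbrev Row : Type u := Fin 2 → KHat K

/-- The group of fractional ideals of `K`. -/
abbrev FracIdeals : Type u := (FractionalIdeal (𝓞 K)⁰ K)ˣ

variable {K}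

/-- Lattices (of rank two) in `(K ⊗ ℝ)²`. -/
structure IsLattice (L : Submodule (𝓞 K) (Row K)) : Prop where
  span_eq_top : Submodule.span (KHat K) (L : Set (Row K)) = ⊤
  fg : L.FG
  rank_two : Module.finrank K (Submodule.span K (L : Set (Row K))) = 2

/-- `L` is isomorphic to `𝓞 K ⊕ 𝔞` for some nonzero ideal `𝔞` of class `c`. -/
def HasSteinitzClass (L : Submodule (𝓞 K) (Row K)) (c : ClassGroup (𝓞 K)) : Prop :=
  ∃ I : (Ideal (𝓞 K))⁰, ClassGroup.mk0 I = c ∧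
    Nonempty (L ≃ₗ[𝓞 K] (𝓞 K × (I : Ideal (𝓞 K))))

open Classical in
/-- The Steinitz class of a lattice (with the value `1` on submodules that have none). -/
def steinitzClass (L : Submodule (𝓞 K) (Row K)) : ClassGroup (𝓞 K) :=
  if h : ∃ c, HasSteinitzClass L c then h.choose else 1

/-- `[M : L] = 𝔞`, the index ideal of `L` in `M`: the product of the elementary divisors of
`M / L`. -/
def HasIndexIdeal (M L : Submodule (𝓞 K) (Row K)) (I : Ideal (𝓞 K)) : Prop :=
  L ≤ M ∧ ∃ I₁ I₂ : Ideal (𝓞 K), I₁ ∣ I₂ ∧ I₁ * I₂ = I ∧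
    Nonempty ((M ⧸ L.submoduleOf M) ≃ₗ[𝓞 K] ((𝓞 K ⧸ I₁) × (𝓞 K ⧸ I₂)))

/-- The product `𝔞 L` of a fractional ideal and a submodule. -/
def fracMul (I : FractionalIdeal (𝓞 K)⁰ K) (L : Submodule (𝓞 K) (Row K)) :
    Submodule (𝓞 K) (Row K) :=
  Submodule.span (𝓞 K) {y | ∃ a ∈ I, ∃ x ∈ L, y = a • x}

/-- Modular points `(L, L')` for `Γ₀(𝔫)`. -/
@[ext]
structure ModularPoint₀ (n : Ideal (𝓞 K)) where
  L : Submodule (𝓞 K) (Row K)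
  L' : Submodule (𝓞 K) (Row K)
  isLattice : IsLattice L
  isLattice' : IsLattice L'
  le : L ≤ L'
  cyclic : Nonempty ((L' ⧸ L.submoduleOf L') ≃ₗ[𝓞 K] (𝓞 K ⧸ n))

/-- Modular points `(L, L', β)` for `Γ₁(𝔫)`; the generator `β` of `L' / L` matters only
modulo `L`, so it is an element of `(K ⊗ ℝ)² / L`. -/
structure ModularPoint₁ (n : Ideal (𝓞 K)) extends ModularPoint₀ n where
  β : Row K ⧸ L
  generates : Submodule.span (𝓞 K) {β} = L'.map L.mkQ

/-- The two kinds of level structure. -/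
inductive LevelKind
  | gamma0
  | gamma1

/-- The set `ℳ` of modular points of level `𝔫`: `ℳ₀(𝔫)` or `ℳ₁(𝔫)`. -/
def ModularPoint (n : Ideal (𝓞 K)) : LevelKind → Type u
  | .gamma0 => ModularPoint₀ n
  | .gamma1 => ModularPoint₁ n

variable {n : Ideal (𝓞 K)}

/-- The underlying `Γ₀(𝔫)`-modular point. -/
def ModularPoint.toPair : {Γ : LevelKind} → ModularPoint n Γ → ModularPoint₀ n
  | .gamma0, P => P
  | .gamma1, P => ModularPoint₁.toModularPoint₀ P

/-- The class of a modular point is that of its underlying lattice. -/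
def ModularPoint.cls {Γ : LevelKind} (P : ModularPoint n Γ) : ClassGroup (𝓞 K) :=
  steinitzClass P.toPair.L

/-- The third components of `P` and `Q` (if any) are given by one and the same vector
`β ∈ L_P' ∩ L_Q'`. No condition for `Γ₀(𝔫)`. -/
def ModularPoint.SameGenerator : {Γ : LevelKind} → ModularPoint n Γ → ModularPoint n Γ → Prop
  | .gamma0, _, _ => True
  | .gamma1, P, Q => ∃ b : Row K,
      b ∈ ModularPoint₀.L' (ModularPoint₁.toModularPoint₀ P) ∧
      b ∈ ModularPoint₀.L' (ModularPoint₁.toModularPoint₀ Q) ∧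
      Submodule.Quotient.mk b = ModularPoint₁.β P ∧
      Submodule.Quotient.mk b = ModularPoint₁.β Q

/-- `Q = (M, M', β)` occurs in the sum that defines `T_𝔞 P`, for `P = (L, L', β)`: `[M : L] = 𝔞`
and `M' = M + L'`. -/
def OccursInT {Γ : LevelKind} (I : Ideal (𝓞 K)) (P Q : ModularPoint n Γ) : Prop :=
  HasIndexIdeal Q.toPair.L P.toPair.L I ∧ Q.toPair.L' = Q.toPair.L ⊔ P.toPair.L' ∧
    P.SameGenerator Q

/-- `Q = (𝔞⁻¹L, 𝔞⁻¹L', β)`, for `P = (L, L', β)` with the representative `β` chosen in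
`L' ∩ 𝔞⁻¹L'`. For `𝔞` coprime to the level there is exactly one such `Q`. -/
def IsScaledBy {Γ : LevelKind} (I : FracIdeals K) (P Q : ModularPoint n Γ) : Prop :=
  Q.toPair.L = fracMul ((I⁻¹ : FracIdeals K) : FractionalIdeal (𝓞 K)⁰ K) P.toPair.L ∧
  Q.toPair.L' = fracMul ((I⁻¹ : FracIdeals K) : FractionalIdeal (𝓞 K)⁰ K) P.toPair.L' ∧
  P.SameGenerator Q

/-- Operators on `ℚℳ`. -/
abbrev RatEnd (n : Ideal (𝓞 K)) (Γ : LevelKind) : Type u :=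
  Module.End ℚ (ModularPoint n Γ →₀ ℚ)

/-- `T_𝔞 (L, L', β) = N(𝔞)⁻¹ ∑ (M, M', β)`, the (finite) sum over `[M : L] = 𝔞`. -/
def opT (n : Ideal (𝓞 K)) (Γ : LevelKind) (I : Ideal (𝓞 K)) : RatEnd n Γ :=
  Finsupp.linearCombination ℚ fun P : ModularPoint n Γ =>
    (Ideal.absNorm I : ℚ)⁻¹ • ∑ᶠ Q ∈ {Q : ModularPoint n Γ | OccursInT I P Q},
      (Finsupp.single Q 1 : ModularPoint n Γ →₀ ℚ)

/-- `T_{𝔞,𝔞} (L, L', β) = N(𝔞)⁻² (𝔞⁻¹L, 𝔞⁻¹L', β)`; the sum has a single term. -/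
def opTT (n : Ideal (𝓞 K)) (Γ : LevelKind) (I : FracIdeals K) : RatEnd n Γ :=
  Finsupp.linearCombination ℚ fun P : ModularPoint n Γ =>
    ((FractionalIdeal.absNorm (I : FractionalIdeal (𝓞 K)⁰ K)) ^ 2)⁻¹ •
      ∑ᶠ Q ∈ {Q : ModularPoint n Γ | IsScaledBy I P Q},
        (Finsupp.single Q 1 : ModularPoint n Γ →₀ ℚ)

/-- The group of fractional ideals coprime to `𝔫`. -/
def coprimeIdeals (n : Ideal (𝓞 K)) : Subgroup (FracIdeals K) :=
  Subgroup.closure {I | ∃ A : Ideal (𝓞 K), IsCoprime A n ∧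
    (I : FractionalIdeal (𝓞 K)⁰ K) = (A : FractionalIdeal (𝓞 K)⁰ K)}

/-- The generators of the Hecke algebra. -/
def generators (n : Ideal (𝓞 K)) (Γ : LevelKind) : Set (RatEnd n Γ) :=
  {T | ∃ I : (Ideal (𝓞 K))⁰, T = opT n Γ I} ∪
    {T | ∃ I ∈ coprimeIdeals n, T = opTT n Γ I}

/-- The Hecke algebra `𝕋` of level `𝔫`, a `ℚ`-algebra of operators on `ℚℳ`. -/
abbrev HeckeAlgebra (n : Ideal (𝓞 K)) (Γ : LevelKind) : Subalgebra ℚ (RatEnd n Γ) :=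
  Algebra.adjoin ℚ (generators n Γ)

/-- `T_𝔞` as an element of `𝕋`. -/
def heckeT (n : Ideal (𝓞 K)) (Γ : LevelKind) (I : (Ideal (𝓞 K))⁰) : HeckeAlgebra n Γ :=
  ⟨opT n Γ I, Algebra.subset_adjoin (Or.inl ⟨I, rfl⟩)⟩

/-- `T_{𝔞,𝔞}` as an element of `𝕋`. -/
def heckeTT (n : Ideal (𝓞 K)) (Γ : LevelKind) (I : coprimeIdeals n) : HeckeAlgebra n Γ :=
  ⟨opTT n Γ I, Algebra.subset_adjoin (Or.inr ⟨I, I.2, rfl⟩)⟩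

/-- `ℚℳ^(c)`, spanned by the modular points of class `c`. -/
def ratPart (n : Ideal (𝓞 K)) (Γ : LevelKind) (c : ClassGroup (𝓞 K)) :
    Submodule ℚ (ModularPoint n Γ →₀ ℚ) :=
  Finsupp.supported ℚ ℚ {P | P.cls = c}

/-- `𝕋_c`: the Hecke operators of class `c`, which map `ℚℳ^(c')` to `ℚℳ^(cc')` for all `c'`. -/
def heckePart (n : Ideal (𝓞 K)) (Γ : LevelKind) (c : ClassGroup (𝓞 K)) :
    Submodule ℚ (HeckeAlgebra n Γ) where
  carrier := {T | ∀ c' : ClassGroup (𝓞 K), ∀ x ∈ ratPart n Γ c',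
    (T : RatEnd n Γ) x ∈ ratPart n Γ (c * c')}
  zero_mem' := fun _ _ _ => Submodule.zero_mem _
  add_mem' := fun hS hT c' x hx => Submodule.add_mem _ (hS c' x hx) (hT c' x hx)
  smul_mem' := fun r _ hT c' x hx => Submodule.smul_mem _ r (hT c' x hx)

theorem one_mem_heckePart (n : Ideal (𝓞 K)) (Γ : LevelKind) :
    (1 : HeckeAlgebra n Γ) ∈ heckePart n Γ 1 := by
  intro c' x hx
  simpa using hx

theorem mul_mem_heckePart {Γ : LevelKind} {c d : ClassGroup (𝓞 K)} {S T : HeckeAlgebra n Γ}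
    (hS : S ∈ heckePart n Γ c) (hT : T ∈ heckePart n Γ d) : S * T ∈ heckePart n Γ (c * d) := by
  intro c' x hx
  have h := hS (d * c') _ (hT c' x hx)
  rwa [← mul_assoc] at h

/-- An eigenvalue system of level `𝔫`. -/
abbrev Eigensystem (n : Ideal (𝓞 K)) (Γ : LevelKind) : Type u := HeckeAlgebra n Γ →+* ℂ

/-- `λ` is not identically zero on `𝕋_c`. -/
def NonzeroOn {Γ : LevelKind} (lam : Eigensystem n Γ) (c : ClassGroup (𝓞 K)) : Prop :=
  ∃ T ∈ heckePart n Γ c, lam T ≠ 0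

theorem NonzeroOn.mul {Γ : LevelKind} {lam : Eigensystem n Γ} {c d : ClassGroup (𝓞 K)}
    (hc : NonzeroOn lam c) (hd : NonzeroOn lam d) : NonzeroOn lam (c * d) := by
  obtain ⟨S, hS, hS0⟩ := hc
  obtain ⟨T, hT, hT0⟩ := hd
  exact ⟨S * T, mul_mem_heckePart hS hT, by rw [map_mul]; exact mul_ne_zero hS0 hT0⟩

theorem NonzeroOn.one {Γ : LevelKind} (lam : Eigensystem n Γ) : NonzeroOn lam 1 :=
  ⟨1, one_mem_heckePart n Γ, by rw [map_one]; exact one_ne_zero⟩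

theorem NonzeroOn.pow {Γ : LevelKind} {lam : Eigensystem n Γ} {c : ClassGroup (𝓞 K)}
    (hc : NonzeroOn lam c) (k : ℕ) : NonzeroOn lam (c ^ k) := by
  induction k with
  | zero => simpa using NonzeroOn.one lam
  | succ k ih => rw [pow_succ]; exact ih.mul hc

/-- The subgroup `H₀(λ)` of the classes `c` such that `λ` is not identically zero on `𝕋_c`. -/
def H₀ {Γ : LevelKind} (lam : Eigensystem n Γ) : Subgroup (ClassGroup (𝓞 K)) where
  carrier := {c | NonzeroOn lam c}
  mul_mem' := fun hc hd => hc.mul hd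
  one_mem' := NonzeroOn.one lam
  inv_mem' := by
    intro c hc
    have h : c⁻¹ = c ^ (orderOf c - 1) := by
      rw [inv_eq_iff_mul_eq_one, ← pow_succ', Nat.sub_add_cancel (orderOf_pos c),
        pow_orderOf_eq_one]
    change NonzeroOn lam c⁻¹
    rw [h]
    exact NonzeroOn.pow hc _

/-- `mu = lam ⊗ ψ` for an unramified character `ψ`, that is, a character of the class group. -/
def IsTwist {Γ : LevelKind} (lam : Eigensystem n Γ) (ψ : ClassGroup (𝓞 K) →* ℂˣ)
    (mu : Eigensystem n Γ) : Prop :=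
  (∀ I : (Ideal (𝓞 K))⁰, mu (heckeT n Γ I) = (ψ (ClassGroup.mk0 I) : ℂ) * lam (heckeT n Γ I)) ∧
  (∀ I : coprimeIdeals n, mu (heckeTT n Γ I) =
    (ψ (ClassGroup.mk (K := K) I.1) : ℂ) ^ 2 * lam (heckeTT n Γ I))

/-- `λ` has a (nontrivial) inner twist: `λ ⊗ ψ = λ` for a nontrivial unramified quadratic
character `ψ`. -/
def HasInnerTwist {Γ : LevelKind} (lam : Eigensystem n Γ) : Prop :=
  ∃ ψ : ClassGroup (𝓞 K) →* ℂˣ, ψ ≠ 1 ∧ ψ ^ 2 = 1 ∧ IsTwist lam ψ lam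

/-- The `ℂ`-linear extension to `ℂℳ` of an operator on `ℚℳ`. -/
def complexify {Γ : LevelKind} (T : RatEnd n Γ) :
    (ModularPoint n Γ →₀ ℂ) →ₗ[ℂ] (ModularPoint n Γ →₀ ℂ) :=
  Finsupp.linearCombination ℂ fun P : ModularPoint n Γ =>
    (T (Finsupp.single P 1)).mapRange (fun q : ℚ => (q : ℂ)) Rat.cast_zero

open Classical in
/-- The component `v_c` of `v ∈ ℂℳ` in `ℂℳ^(c)`. -/
def component {Γ : LevelKind} (c : ClassGroup (𝓞 K)) (v : ModularPoint n Γ →₀ ℂ) :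
    ModularPoint n Γ →₀ ℂ :=
  v.filter fun P => P.cls = c

/-- `v ∈ ℂℳ` is a simultaneous eigenvector with eigensystem `λ`. -/
def IsEigenvector {Γ : LevelKind} (lam : Eigensystem n Γ) (v : ModularPoint n Γ →₀ ℂ) : Prop :=
  v ≠ 0 ∧ ∀ T : HeckeAlgebra n Γ, complexify (T : RatEnd n Γ) v = lam T • v

/-- A complex representation `V` of `𝕋` with a decomposition `V = ⊕ V_c` indexed by the class
group such that `T V_c' ⊆ V_cc'` for `T ∈ 𝕋_c`. -/
structure IsClassGraded {Γ : LevelKind} {V : Type*} [AddCommGroup V] [Module ℂ V]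
    (ρ : HeckeAlgebra n Γ →+* Module.End ℂ V) (W : ClassGroup (𝓞 K) → Submodule ℂ V) : Prop where
  indep : iSupIndep W
  iSup_eq_top : iSup W = ⊤
  map_mem : ∀ c c' : ClassGroup (𝓞 K), ∀ T ∈ heckePart n Γ c, ∀ x ∈ W c', ρ T x ∈ W (c * c')

end HeckePoints

end

/-! If `T` has class h, comparing the components of `T v = λ(T) v` gives `T v_c = λ(T) v_{hc}`.
Hence `v_c = 0` and `λ(T) ≠ 0` force `v_{hc} = 0`, so vanishing spreads over cosets of `H₀ lam`
(`components_of_eigenvector`).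

It remains to see that `H₀ lam` is everything when there is no inner twist. The operator `T_{𝔞,𝔞}`
is invertible and of class `[𝔞]⁻²`, and every class contains an ideal prime to the level, so `H₀
lam` contains all squares (`sq_mem_H₀`). If it were proper, a nontrivial character ψ of the quotient
would be quadratic. Then ψ² = 1 on the `T_{𝔞,𝔞}`, and `λ(T_𝔞) ≠ 0` puts `[𝔞]` into `H₀ lam`, where ψ
is trivial; so `λ ⊗ ψ = λ` (`H₀_eq_top`). A group of odd order has no nontrivial quadratic
character.

Most of the work lies in the classes of the generators. This needs Steinitz's theorem for modules of
rank two: existence (`IsRankTwo.exists_equiv`) and uniqueness (`HasClass.unique`) of the class, and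
its change under passage to a sublattice (`HasClass.of_hasIndexIdeal`) and under scaling
(`HasClass.fracMul`). -/

noncomputable section

namespace HeckePoints

/-! ### Modules of rank two and their functionals. -/

section SteinitzTheory

variable {R : Type*} [CommRing R] {M N : Type*} [AddCommGroup M] [Module R M]
  [AddCommGroup N] [Module R N]

/-- `M` embeds in `R²` with image of rank two. -/
def IsRankTwo (R M : Type*) [CommRing R] [AddCommGroup M] [Module R M] : Prop :=
  ∃ α β : M →ₗ[R] R, (∀ m, α m = 0 → β m = 0 → m = 0) ∧
    ∃ p q : M, α p * β q - α q * β p ≠ 0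

theorem IsRankTwo.of_linearEquiv (e : N ≃ₗ[R] M) (h : IsRankTwo R M) : IsRankTwo R N := by
  obtain ⟨α, β, hinj, p, q, hpq⟩ := h
  refine ⟨α ∘ₗ e, β ∘ₗ e, fun m h1 h2 => ?_, e.symm p, e.symm q, by simpa using hpq⟩
  simpa using hinj (e m) h1 h2

theorem isRankTwo_prod [IsDomain R] {A B : Ideal R} (hA : A ≠ ⊥) (hB : B ≠ ⊥) :
    IsRankTwo R (A × B) := by
  obtain ⟨a, ha, ha0⟩ := Submodule.exists_mem_ne_zero_of_ne_bot hA
  obtain ⟨b, hb, hb0⟩ := Submodule.exists_mem_ne_zero_of_ne_bot hB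
  refine ⟨A.subtype ∘ₗ LinearMap.fst R A B, B.subtype ∘ₗ LinearMap.snd R A B,
    fun m h1 h2 => Prod.ext (Subtype.ext h1) (Subtype.ext h2),
    (⟨a, ha⟩, 0), (0, ⟨b, hb⟩), by simp [ha0, hb0]⟩

/-- A nonzero functional on a module of rank two has kernel isomorphic to an ideal. -/
theorem IsRankTwo.exists_ker_equiv [IsDomain R] (h : IsRankTwo R M) (φ : M →ₗ[R] R)
    (hφ : φ ≠ 0) : ∃ C : Ideal R, C ≠ ⊥ ∧ Nonempty (φ.ker ≃ₗ[R] C) := by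
  obtain ⟨α, β, hinj, p, q, hpq⟩ := h
  -- Cramer's rule, verified after applying the jointly injective pair `α`, `β`.
  have cramer : ∀ m, (α p * β q - α q * β p) • m =
      (α m * β q - α q * β m) • p + (α p * β m - α m * β p) • q := by
    intro m
    refine sub_eq_zero.mp (hinj _ ?_ ?_) <;> simp <;> ring
  have smul_eq_zero_imp : ∀ (r : R) (m : M), r ≠ 0 → r • m = 0 → m = 0 := by
    intro r m hr hm
    refine hinj m ?_ ?_
    · have := congrArg α hm; simpa [hr] using this
    · have := congrArg β hm; simpa [hr] using this
  -- A functional injective on the kernel suffices. Its image is nonzero: if the kernel vector `φ p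
  -- • q - φ q • p` vanished, then `φ p = φ q = 0`, and Cramer's rule would give `φ = 0`.
  have aux : ∀ ψ : φ.ker →ₗ[R] R, (∀ m, ψ m = 0 → m = 0) →
      ∃ C : Ideal R, C ≠ ⊥ ∧ Nonempty (φ.ker ≃ₗ[R] C) := by
    intro ψ hψ
    have hinjψ : Function.Injective ψ := (injective_iff_map_eq_zero ψ).mpr hψ
    refine ⟨LinearMap.range ψ, ?_, ⟨LinearEquiv.ofInjective ψ hinjψ⟩⟩
    intro hr
    rw [LinearMap.range_eq_bot] at hr
    have hall : ∀ m : φ.ker, m = 0 := fun m => hψ m (by rw [hr]; rfl)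
    have hw : φ p • q - φ q • p = 0 :=
      congrArg Subtype.val (hall ⟨φ p • q - φ q • p, by simp [mul_comm]⟩)
    have h1 := congrArg α hw
    have h2 := congrArg β hw
    simp only [map_sub, map_smul, smul_eq_mul, map_zero] at h1 h2
    have hp : φ p = 0 := (mul_eq_zero.mp (show φ p * (α p * β q - α q * β p) = 0 by
      linear_combination α p * h2 - β p * h1)).resolve_right hpq
    have hq : φ q = 0 := (mul_eq_zero.mp (show φ q * (α p * β q - α q * β p) = 0 by
      linear_combination α q * h2 - β q * h1)).resolve_right hpq
    refine hφ (LinearMap.ext fun m => ?_)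
    have := congrArg φ (cramer m)
    simpa [hp, hq, hpq] using this
  -- The functional is `det(p, ·)` if `φ q = 0` and `det(·, q)` otherwise. If it kills a kernel
  -- vector, applying `φ` to Cramer's rule kills the other determinant too.
  by_cases hq : φ q = 0
  · by_cases hp : φ p = 0
    · refine absurd (LinearMap.ext fun m => ?_) hφ
      have := congrArg φ (cramer m)
      simpa [hp, hq, hpq] using this
    · refine aux ((α p • β - β p • α) ∘ₗ φ.ker.subtype) fun m hm => Subtype.ext ?_
      have hm' : α p * β m - α m * β p = 0 := by
        simpa [mul_comm] using hm
      have h1 := congrArg φ (cramer m)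
      have hφm : φ (m : M) = 0 := m.2
      simp only [hm', map_smul, hφm, zero_smul, add_zero, smul_eq_mul] at h1
      have h2 := (mul_eq_zero.mp (h1.symm.trans (mul_zero _))).resolve_right hp
      have h3 := cramer m
      rw [hm', h2, zero_smul, zero_smul, add_zero] at h3
      exact smul_eq_zero_imp _ _ hpq h3
  · refine aux ((β q • α - α q • β) ∘ₗ φ.ker.subtype) fun m hm => Subtype.ext ?_
    have hm' : α m * β q - α q * β m = 0 := by
      simpa [mul_comm] using hm
    have h1 := congrArg φ (cramer m)
    have hφm : φ (m : M) = 0 := m.2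
    simp only [hm', map_smul, hφm, zero_smul, zero_add, smul_eq_mul] at h1
    have h2 := (mul_eq_zero.mp (h1.symm.trans (mul_zero _))).resolve_right hq
    have h3 := cramer m
    rw [hm', h2, zero_smul, zero_smul, add_zero] at h3
    exact smul_eq_zero_imp _ _ hpq h3

theorem projective_of_isTorsionFree [IsDedekindDomain R] [Module.Finite R M]
    [Module.IsTorsionFree R M] : Module.Projective R M :=
  have : Module.FinitePresentation R M := Module.finitePresentation_of_finite R M
  Module.Flat.projective_of_finitePresentation

theorem projective_ideal [IsDedekindDomain R] (I : Ideal R) : Module.Projective R I :=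
  projective_of_isTorsionFree

/-- The preimages of ideals under a nonzero functional on a module of rank two. -/
theorem IsRankTwo.exists_comap_equiv [IsDedekindDomain R] (h : IsRankTwo R M) (φ : M →ₗ[R] R)
    (hφ : φ ≠ 0) : ∃ C : Ideal R, C ≠ ⊥ ∧
      ∀ I : Ideal R, Nonempty (Submodule.comap φ I ≃ₗ[R]
        (LinearMap.range φ ⊓ I : Submodule R R) × C) := by
  obtain ⟨C, hC, ⟨e⟩⟩ := h.exists_ker_equiv φ hφ
  refine ⟨C, hC, fun I => ?_⟩
  -- The image of `φ` is projective, so `φ` splits over it. The complement is the kernel, the same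
  -- for every `I`, so one `C` serves all `I`.
  have := projective_ideal (LinearMap.range φ)
  obtain ⟨s, hs⟩ := φ.rangeRestrict.exists_rightInverse_of_surjective φ.range_rangeRestrict
  have hs' : ∀ x : LinearMap.range φ, φ (s x) = x := fun x =>
    congrArg Subtype.val (LinearMap.congr_fun hs x)
  let f : Submodule.comap φ I →ₗ[R] (LinearMap.range φ ⊓ I : Submodule R R) :=
    LinearMap.codRestrict _ (φ ∘ₗ Submodule.subtype _)
      fun m => ⟨⟨m, rfl⟩, m.2⟩
  let g : Submodule.comap φ I →ₗ[R] φ.ker :=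
    LinearMap.codRestrict _ (Submodule.subtype _ - s ∘ₗ φ.rangeRestrict ∘ₗ Submodule.subtype _)
      fun m => by simp [LinearMap.mem_ker, hs']
  have hbij : Function.Bijective (f.prod g) := by
    constructor
    · rw [injective_iff_map_eq_zero]
      intro m hm
      have h1 : φ m = 0 := congrArg (fun x => (x.1 : R)) hm
      have h2 : (m : M) - s (φ.rangeRestrict m) = 0 := congrArg (fun x => (x.2 : M)) hm
      have h3 : φ.rangeRestrict (m : M) = 0 := Subtype.ext h1
      rw [h3, map_zero, sub_zero] at h2
      exact Subtype.ext h2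
    · rintro ⟨x, y⟩
      have hy : φ (y : M) = 0 := y.2
      have hm : φ (s ⟨x, x.2.1⟩ + y) = x := by rw [map_add, hs', hy, add_zero]
      refine ⟨⟨s ⟨x, x.2.1⟩ + y, ?_⟩, Prod.ext (Subtype.ext hm) (Subtype.ext ?_)⟩
      · rw [Submodule.mem_comap, hm]; exact x.2.2
      · have h3 : φ.rangeRestrict (s ⟨x, x.2.1⟩ + y) = ⟨x, x.2.1⟩ := Subtype.ext hm
        change s ⟨x, x.2.1⟩ + (y : M) - s (φ.rangeRestrict (s ⟨x, x.2.1⟩ + y)) = y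
        rw [h3, add_sub_cancel_left]
  exact ⟨(LinearEquiv.ofBijective _ hbij).trans ((LinearEquiv.refl R _).prodCongr e)⟩

/-- `M` is isomorphic to `A × B` with `[A] [B] = c`. -/
def HasClass (R M : Type*) [CommRing R] [IsDedekindDomain R] [AddCommGroup M] [Module R M]
    (c : ClassGroup R) : Prop :=
  ∃ A B : (Ideal R)⁰, ClassGroup.mk0 A * ClassGroup.mk0 B = c ∧
    Nonempty (M ≃ₗ[R] A.1 × B.1)

/-! ### Steinitz classes over a Dedekind domain. -/

section Dedekind

variable [IsDedekindDomain R]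

theorem HasClass.of_linearEquiv {c : ClassGroup R} (h : HasClass R M c) (e : N ≃ₗ[R] M) :
    HasClass R N c := by
  obtain ⟨A, B, hc, ⟨f⟩⟩ := h
  exact ⟨A, B, hc, ⟨e.trans f⟩⟩

theorem HasClass.isRankTwo {c : ClassGroup R} (h : HasClass R M c) : IsRankTwo R M := by
  obtain ⟨A, B, -, ⟨e⟩⟩ := h
  exact (isRankTwo_prod (nonZeroDivisors.coe_ne_zero A)
    (nonZeroDivisors.coe_ne_zero B)).of_linearEquiv e

/-- The determinant of two vectors in `A × B ⊆ R²`. -/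
def det₂ {A B : Ideal R} (p q : A × B) : R := (p.1 : R) * q.2 - (q.1 : R) * p.2

/-- Multiplicativity of the determinant over the fraction field, with denominators cleared: the
matrix of `f` has columns `f (a, 0) / a` and `f (0, b) / b`. -/
theorem det₂_map {A B A' B' : Ideal R} (f : A × B →ₗ[R] A' × B') (a : A) (b : B) (p q : A × B)
    (ha : (a : R) ≠ 0) (hb : (b : R) ≠ 0) :
    (a : R) * b * det₂ (f p) (f q) = det₂ p q * det₂ (f (a, 0)) (f (0, b)) := by
  have key : ∀ p : A × B, ((a : R) * b) • f p =
      ((b : R) * p.1) • f (a, 0) + ((a : R) * p.2) • f (0, b) := by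
    intro p
    rw [← map_smul, ← map_smul, ← map_smul, ← map_add]
    congr 1
    refine Prod.ext (Subtype.ext ?_) (Subtype.ext ?_) <;> simp <;> ring
  have h1 : ∀ p, (a : R) * b * (f p).1 =
      b * p.1 * (f (a, 0)).1 + a * p.2 * (f (0, b)).1 := fun p =>
    congrArg (fun x => (x.1 : R)) (key p)
  have h2 : ∀ p, (a : R) * b * (f p).2 =
      b * p.1 * (f (a, 0)).2 + a * p.2 * (f (0, b)).2 := fun p =>
    congrArg (fun x => (x.2 : R)) (key p)
  refine mul_left_cancel₀ (mul_ne_zero ha hb) ?_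
  simp only [det₂]
  have e : (a : R) * b * (a * b * ((f p).1 * (f q).2 - (f q).1 * (f p).2)) =
    (a * b * (f p).1) * (a * b * (f q).2) - (a * b * (f q).1) * (a * b * (f p).2) := by ring
  rw [e, h1, h1, h2, h2]
  ring

/-- Products `x y` generate `A * B`, and `x y` is the determinant of `(x, 0)` and `(0, y)`, whose
images have determinant in `A' * B'`. -/
theorem span_det₂_mul_le {A B A' B' : Ideal R} (f : A × B →ₗ[R] A' × B') (a : A) (b : B)
    (ha : (a : R) ≠ 0) (hb : (b : R) ≠ 0) :
    Ideal.span {det₂ (f (a, 0)) (f (0, b))} * (A * B) ≤ Ideal.span {(a : R) * b} * (A' * B') := by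
  have hdet : ∀ p q : A' × B', det₂ p q ∈ A' * B' := fun p q =>
    Ideal.sub_mem _ (Ideal.mul_mem_mul p.1.2 q.2.2) (Ideal.mul_mem_mul q.1.2 p.2.2)
  rw [Ideal.span_singleton_mul_le_iff]
  intro z hz
  induction hz using Submodule.mul_induction_on' with
  | mem_mul_mem x hx y hy =>
    have h := det₂_map f a b (⟨x, hx⟩, 0) (0, ⟨y, hy⟩) ha hb
    rw [Ideal.mem_span_singleton_mul]
    refine ⟨_, hdet (f (⟨x, hx⟩, 0)) (f (0, ⟨y, hy⟩)), h.trans ?_⟩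
    simp [det₂, mul_comm]
  | add x hx y hy ihx ihy => rw [mul_add]; exact Ideal.add_mem _ ihx ihy

/-- The isomorphism and its inverse give opposite inclusions between multiples of `A * B` and `A' *
B'`. As the two determinants are inverse up to the chosen scalars (`hmul`), these are equalities,
and the ideals differ by principal factors. -/
theorem HasClass.unique {c d : ClassGroup R} (h : HasClass R M c) (h' : HasClass R M d) :
    c = d := by
  obtain ⟨A, B, rfl, ⟨e⟩⟩ := h
  obtain ⟨A', B', rfl, ⟨e'⟩⟩ := h'
  obtain ⟨a, ha, ha0⟩ := Submodule.exists_mem_ne_zero_of_ne_bot (nonZeroDivisors.coe_ne_zero A)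
  obtain ⟨b, hb, hb0⟩ := Submodule.exists_mem_ne_zero_of_ne_bot (nonZeroDivisors.coe_ne_zero B)
  obtain ⟨a', ha', ha0'⟩ := Submodule.exists_mem_ne_zero_of_ne_bot
    (nonZeroDivisors.coe_ne_zero A')
  obtain ⟨b', hb', hb0'⟩ := Submodule.exists_mem_ne_zero_of_ne_bot
    (nonZeroDivisors.coe_ne_zero B')
  let f : (A.1 × B.1) ≃ₗ[R] A'.1 × B'.1 := e.symm.trans e'
  set δ := det₂ (f (⟨a, ha⟩, 0)) (f (0, ⟨b, hb⟩)) with hδ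
  set δ' := det₂ (f.symm (⟨a', ha'⟩, 0)) (f.symm (0, ⟨b', hb'⟩)) with hδ'
  have hmul : a' * b' * (a * b) = δ * δ' := by
    have := det₂_map f.symm.toLinearMap ⟨a', ha'⟩ ⟨b', hb'⟩ (f (⟨a, ha⟩, 0)) (f (0, ⟨b, hb⟩))
      ha0' hb0'
    simp only [LinearEquiv.coe_coe, LinearEquiv.symm_apply_apply] at this
    rw [← hδ, ← hδ'] at this
    rw [← this]
    simp [det₂]
  have h0 : δ * δ' ≠ 0 := hmul ▸ mul_ne_zero (mul_ne_zero ha0' hb0') (mul_ne_zero ha0 hb0)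
  have hδ0 : δ ≠ 0 := left_ne_zero_of_mul h0
  have hδ0' : δ' ≠ 0 := right_ne_zero_of_mul h0
  have h1 : Ideal.span {δ} * ((A : Ideal R) * B) ≤ Ideal.span {a * b} * ((A' : Ideal R) * B') :=
    span_det₂_mul_le f.toLinearMap ⟨a, ha⟩ ⟨b, hb⟩ ha0 hb0
  have h2 : Ideal.span {δ'} * ((A' : Ideal R) * B') ≤
      Ideal.span {a' * b'} * ((A : Ideal R) * B) :=
    span_det₂_mul_le f.symm.toLinearMap ⟨a', ha'⟩ ⟨b', hb'⟩ ha0' hb0'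
  have h3 : Ideal.span {δ} * ((A : Ideal R) * B) = Ideal.span {a * b} * ((A' : Ideal R) * B') := by
    refine le_antisymm h1 ?_
    have h4 := Ideal.mul_mono_right (I := Ideal.span {a * b}) h2
    have h5 : Ideal.span {a * b} * (Ideal.span {a' * b'} * ((A : Ideal R) * B)) =
        Ideal.span {δ'} * (Ideal.span {δ} * ((A : Ideal R) * B)) := by
      rw [← mul_assoc, ← mul_assoc (Ideal.span {δ'}), Ideal.span_singleton_mul_span_singleton,
        Ideal.span_singleton_mul_span_singleton, mul_comm (a * b), hmul, mul_comm δ]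
    rw [h5, mul_left_comm] at h4
    rwa [← Ideal.dvd_iff_le, mul_dvd_mul_iff_left, Ideal.dvd_iff_le] at h4
    simpa using hδ0'
  rw [← map_mul, ← map_mul, ClassGroup.mk0_eq_mk0_iff]
  exact ⟨δ, a * b, hδ0, mul_ne_zero ha0 hb0, h3⟩

/-- Every ideal class contains an ideal coprime to a given nonzero ideal. -/
theorem exists_mk0_eq_isCoprime (c : ClassGroup R) {B : Ideal R} (hB : B ≠ ⊥) :
    ∃ A : (Ideal R)⁰, ClassGroup.mk0 A = c ∧ IsCoprime (A : Ideal R) B := by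
  obtain ⟨D, hD⟩ := ClassGroup.mk0_surjective c⁻¹
  have hD0 : (D : Ideal R) ≠ 0 := nonZeroDivisors.coe_ne_zero D
  have hDB : (D : Ideal R) * B ≠ 0 := mul_ne_zero hD0 hB
  -- Only in this case could the complementary ideal `A` below be zero.
  by_cases hB1 : B = ⊤
  · obtain ⟨A, hA⟩ := ClassGroup.mk0_surjective c
    exact ⟨A, hA, by rw [hB1, ← Ideal.one_eq_top]; exact isCoprime_one_right⟩
  -- Choose `a` with `D * B + (a) = D` and write `(a) = D * A`. Cancelling `D` gives `B + A = R`,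
  -- and `A` has class inverse to that of `D`.
  obtain ⟨a, ha⟩ := IsDedekindDomain.exists_sup_span_eq
    (show (D : Ideal R) * B ≤ D from Ideal.mul_le_left) hDB
  obtain ⟨A, hA⟩ := Ideal.dvd_iff_le.mpr (show Ideal.span {a} ≤ D from ha ▸ le_sup_right)
  have hcop : B ⊔ A = ⊤ := by
    rw [hA, ← Ideal.mul_sup] at ha
    refine mul_left_cancel₀ hD0 ?_
    rw [ha, Ideal.mul_top]
  have hA0 : A ≠ 0 := by
    rintro rfl
    exact hB1 (by simpa using hcop)
  have ha0 : a ≠ 0 := by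
    rintro rfl
    have : (D : Ideal R) * A = 0 := by rw [← hA]; simp
    exact mul_ne_zero hD0 hA0 this
  refine ⟨⟨A, mem_nonZeroDivisors_of_ne_zero hA0⟩, ?_, ?_⟩
  · rw [← inv_inj, ← hD, eq_comm, ClassGroup.mk0_eq_mk0_inv_iff]
    exact ⟨a, ha0, hA.symm⟩
  · rw [isCoprime_comm, Ideal.isCoprime_iff_sup_eq]
    exact hcop

theorem nonempty_equiv_of_mk0_eq {A B : (Ideal R)⁰} (h : ClassGroup.mk0 A = ClassGroup.mk0 B) :
    Nonempty ((A : Ideal R) ≃ₗ[R] (B : Ideal R)) := by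
  obtain ⟨x, y, hx, hy, hxy⟩ := ClassGroup.mk0_eq_mk0_iff.mp h
  have key : ∀ (r : R) (_ : r ≠ 0) (I : Ideal R),
      Nonempty (I ≃ₗ[R] (Ideal.span {r} * I : Ideal R)) := by
    intro r hr I
    have hinj : Function.Injective (LinearMap.mulLeft R r) := mul_right_injective₀ hr
    refine ⟨(Submodule.equivMapOfInjective _ hinj I).trans (LinearEquiv.ofEq _ _ ?_)⟩
    ext z
    rw [Ideal.mem_span_singleton_mul]
    simp
  obtain ⟨e⟩ := key x hx A
  obtain ⟨e'⟩ := key y hy B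
  exact ⟨(e.trans (LinearEquiv.ofEq _ _ hxy)).trans e'.symm⟩

/-- Splitting off one functional gives a sum of two ideals. Within its class the first may be taken
coprime to the second; then addition is a functional onto `R`, and splitting it off leaves a free
summand. -/
theorem IsRankTwo.exists_equiv (h : IsRankTwo R M) :
    ∃ C : (Ideal R)⁰, Nonempty (M ≃ₗ[R] R × C.1) := by
  have topEquiv : ∀ {M : Type _} [AddCommGroup M] [Module R M] (φ : M →ₗ[R] R), IsRankTwo R M →
      φ ≠ 0 → ∃ C : Ideal R, C ≠ ⊥ ∧ Nonempty (M ≃ₗ[R] LinearMap.range φ × C) := by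
    intro M _ _ φ h hφ
    obtain ⟨C, hC, hI⟩ := h.exists_comap_equiv φ hφ
    obtain ⟨e⟩ := hI ⊤
    exact ⟨C, hC, ⟨(Submodule.topEquiv.symm.trans (LinearEquiv.ofEq _ _ (by simp))).trans
      (e.trans ((LinearEquiv.ofEq _ _ (by simp)).prodCongr (LinearEquiv.refl R C)))⟩⟩
  obtain ⟨α, β, hinj, p, q, hpq⟩ := id h
  have hα : α ≠ 0 := by rintro rfl; simp at hpq
  obtain ⟨B, hB, ⟨e⟩⟩ := topEquiv α h hα
  have hr : LinearMap.range α ≠ (⊥ : Ideal R) := fun h0 => hα (LinearMap.range_eq_bot.mp h0)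
  obtain ⟨A, hA, hAB⟩ := exists_mk0_eq_isCoprime
    (ClassGroup.mk0 ⟨LinearMap.range α, mem_nonZeroDivisors_of_ne_zero hr⟩) hB
  obtain ⟨f⟩ := nonempty_equiv_of_mk0_eq hA
  let g : M ≃ₗ[R] A.1 × B := e.trans (f.symm.prodCongr (LinearEquiv.refl R B))
  let φ : M →ₗ[R] R := (A : Ideal R).subtype.coprod B.subtype ∘ₗ g.toLinearMap
  have hφ : LinearMap.range φ = ⊤ := by
    rw [LinearMap.range_comp_of_range_eq_top _ (LinearEquiv.range g), LinearMap.range_coprod,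
      Submodule.range_subtype, Submodule.range_subtype]
    exact Ideal.isCoprime_iff_sup_eq.mp hAB
  obtain ⟨C, hC, ⟨k⟩⟩ := topEquiv φ h (by
    intro h0
    rw [h0, LinearMap.range_zero] at hφ
    exact bot_ne_top hφ)
  exact ⟨⟨C, mem_nonZeroDivisors_of_ne_zero hC⟩, ⟨k.trans
    (((LinearEquiv.ofEq _ _ hφ).trans Submodule.topEquiv).prodCongr (LinearEquiv.refl R C))⟩⟩

theorem HasClass.of_equiv_prod {C : (Ideal R)⁰} (e : M ≃ₗ[R] R × C.1) :
    HasClass R M (ClassGroup.mk0 C) :=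
  ⟨1, C, by simp, ⟨e.trans (((LinearEquiv.ofEq _ _ Ideal.one_eq_top).trans
    Submodule.topEquiv).symm.prodCongr (LinearEquiv.refl R _))⟩⟩

theorem HasClass.projective {c : ClassGroup R} (h : HasClass R M c) : Module.Projective R M := by
  obtain ⟨A, B, -, ⟨e⟩⟩ := h
  have := projective_ideal (A : Ideal R)
  have := projective_ideal (B : Ideal R)
  exact Module.Projective.of_equiv e.symm

/-- The class of the kernel of a surjection to a cyclic torsion module. -/
theorem HasClass.ker {c : ClassGroup R} (h : HasClass R M c) (I : (Ideal R)⁰)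
    (π : M →ₗ[R] R ⧸ I.1) (hπ : Function.Surjective π) :
    HasClass R (LinearMap.ker π) (ClassGroup.mk0 I * c) := by
  -- Treated apart, because here the lift `φ` used below could be zero.
  by_cases hI : (I : Ideal R) = ⊤
  · have h1 : I = 1 := Subtype.ext (by rw [hI]; exact Ideal.one_eq_top.symm)
    have hk : LinearMap.ker π = ⊤ := by
      have : Subsingleton (R ⧸ (I : Ideal R)) := Ideal.Quotient.subsingleton_iff.mpr hI
      exact eq_top_iff.mpr fun x _ => Subsingleton.elim _ _
    have h2 : ClassGroup.mk0 I * c = c := by rw [h1, map_one, one_mul]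
    rw [h2]
    exact h.of_linearEquiv ((LinearEquiv.ofEq _ _ hk).trans Submodule.topEquiv)
  have := h.projective
  -- With a lift `φ` of `π`, the kernel of `π` is the preimage of `I`, and the image of `φ` is
  -- coprime to `I`. So passing from `M` to the kernel replaces the summand `range φ` by `I * range
  -- φ` and keeps `C`.
  obtain ⟨φ, hφ⟩ := Module.projective_lifting_property (Submodule.mkQ (I : Ideal R)) π
    (Submodule.mkQ_surjective _)
  have hker : LinearMap.ker π = Submodule.comap φ (I : Ideal R) := by
    rw [← hφ, LinearMap.ker_comp, Submodule.ker_mkQ]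
  have hcop : LinearMap.range φ ⊔ (I : Ideal R) = ⊤ := by
    rw [eq_top_iff]
    intro x _
    obtain ⟨m, hm⟩ := hπ (Submodule.Quotient.mk x)
    rw [← hφ] at hm
    have hm' : φ m - x ∈ (I : Ideal R) := (Submodule.Quotient.eq _).mp hm
    have : x = φ m - (φ m - x) := by ring
    rw [this]
    exact Submodule.sub_mem _ (Submodule.mem_sup_left ⟨m, rfl⟩) (Submodule.mem_sup_right hm')
  have hφ0 : φ ≠ 0 := by
    rintro rfl
    rw [LinearMap.range_zero, bot_sup_eq] at hcop
    exact hI hcop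
  have hr : LinearMap.range φ ≠ (⊥ : Ideal R) := fun h0 => hφ0 (LinearMap.range_eq_bot.mp h0)
  obtain ⟨C, hC, hC'⟩ := h.isRankTwo.exists_comap_equiv φ hφ0
  let J : (Ideal R)⁰ := ⟨LinearMap.range φ, mem_nonZeroDivisors_of_ne_zero hr⟩
  let C₀ : (Ideal R)⁰ := ⟨C, mem_nonZeroDivisors_of_ne_zero hC⟩
  obtain ⟨e⟩ := hC' ⊤
  obtain ⟨f⟩ := hC' I
  have hc : HasClass R M (ClassGroup.mk0 J * ClassGroup.mk0 C₀) :=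
    ⟨J, C₀, rfl, ⟨(Submodule.topEquiv.symm.trans (LinearEquiv.ofEq _ _ (by simp))).trans
      (e.trans ((LinearEquiv.ofEq _ _ (show LinearMap.range φ ⊓ ⊤ = J.1 from inf_top_eq _)).prodCongr
        (LinearEquiv.refl R C)))⟩⟩
  rw [h.unique hc, ← mul_assoc, ← map_mul]
  refine ⟨I * J, C₀, rfl, ⟨((LinearEquiv.ofEq _ _ hker).trans f).trans
    ((LinearEquiv.ofEq _ _ ?_).prodCongr (LinearEquiv.refl R C))⟩⟩
  rw [inf_comm]
  exact (Ideal.mul_eq_inf_of_coprime (sup_comm (LinearMap.range φ) (I : Ideal R) ▸ hcop)).symm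

/-- The class of a submodule with cyclic torsion quotient. -/
theorem HasClass.of_exact {c : ClassGroup R} (h : HasClass R M c) (I : (Ideal R)⁰)
    (ι : N →ₗ[R] M) (hι : Function.Injective ι) (π : M →ₗ[R] R ⧸ I.1)
    (hπ : Function.Surjective π) (hexact : ∀ m, π m = 0 ↔ m ∈ LinearMap.range ι) :
    HasClass R N (ClassGroup.mk0 I * c) :=
  (h.ker I π hπ).of_linearEquiv ((LinearEquiv.ofInjective ι hι).trans
    (LinearEquiv.ofEq _ _ (Submodule.ext fun m => (hexact m).symm)))

/-- The product of two submodules, as a module. -/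
def submoduleProdEquiv (S : Submodule R M) (T : Submodule R N) : S.prod T ≃ₗ[R] S × T where
  toFun x := (⟨x.1.1, x.2.1⟩, ⟨x.1.2, x.2.2⟩)
  invFun x := ⟨(x.1, x.2), x.1.2, x.2.2⟩
  map_add' _ _ := rfl
  map_smul' _ _ := rfl
  left_inv _ := rfl
  right_inv _ := rfl

/-- The class of `J M`. -/
theorem HasClass.smul_top {c : ClassGroup R} (h : HasClass R M c) (J : (Ideal R)⁰) :
    HasClass R ((J : Ideal R) • (⊤ : Submodule R M) : Submodule R M)
      (ClassGroup.mk0 J ^ 2 * c) := by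
  obtain ⟨A, B, rfl, ⟨e⟩⟩ := h
  refine ⟨J * A, J * B, by rw [map_mul, map_mul, sq]; exact mul_mul_mul_comm _ _ _ _, ?_⟩
  let ι : M →ₗ[R] R × R := ((A : Ideal R).subtype.prodMap (B : Ideal R).subtype) ∘ₗ e.toLinearMap
  have hι : Function.Injective ι :=
    (Prod.map_injective.mpr ⟨Subtype.val_injective, Subtype.val_injective⟩).comp e.injective
  have hr : LinearMap.range ι = Submodule.prod (A : Ideal R) (B : Ideal R) := by
    rw [LinearMap.range_comp_of_range_eq_top _ (LinearEquiv.range e), LinearMap.range_prodMap,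
      Submodule.range_subtype, Submodule.range_subtype]
  have himg : Submodule.map ι ((J : Ideal R) • (⊤ : Submodule R M)) =
      Submodule.prod (J.1 * A.1) (J.1 * B.1) := by
    rw [Submodule.map_smul'', Submodule.map_top, hr]
    refine le_antisymm (Submodule.smul_le.mpr fun r hr p hp =>
      ⟨Ideal.mul_mem_mul hr hp.1, Ideal.mul_mem_mul hr hp.2⟩) ?_
    have h1 : Submodule.map (LinearMap.inl R R R) ((J : Ideal R) • (A : Ideal R)) ≤
        (J : Ideal R) • Submodule.prod (A : Ideal R) (B : Ideal R) := by
      rw [Submodule.map_smul'']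
      refine smul_mono_right _ ?_
      rintro _ ⟨x, hx, rfl⟩
      exact ⟨hx, Submodule.zero_mem _⟩
    have h2 : Submodule.map (LinearMap.inr R R R) ((J : Ideal R) • (B : Ideal R)) ≤
        (J : Ideal R) • Submodule.prod (A : Ideal R) (B : Ideal R) := by
      rw [Submodule.map_smul'']
      refine smul_mono_right _ ?_
      rintro _ ⟨x, hx, rfl⟩
      exact ⟨Submodule.zero_mem _, hx⟩
    rintro ⟨x, y⟩ ⟨hx, hy⟩
    have : (x, y) = (x, 0) + (0, y) := by simp
    rw [this]
    exact Submodule.add_mem _ (h1 ⟨x, hx, rfl⟩) (h2 ⟨y, hy, rfl⟩)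
  exact ⟨((Submodule.equivMapOfInjective ι hι _).trans (LinearEquiv.ofEq _ _ himg)).trans
    (submoduleProdEquiv (J.1 * A.1) (J.1 * B.1))⟩

end Dedekind

end SteinitzTheory

/-! ### Steinitz classes of lattices, sublattices and fractional multiples. -/

section Lattices

variable {K : Type*} [Field K] [NumberField K]

/-- Coordinates in a `K`-basis of the span, multiplied by a common denominator for finitely many
generators, are integral functionals. -/
theorem isRankTwo_of_fg {E : Type*} [AddCommGroup E] [Module K E] [Module (𝓞 K) E]
    [IsScalarTower (𝓞 K) K E] (L : Submodule (𝓞 K) E) (hfg : L.FG)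
    (hrank : Module.finrank K (Submodule.span K (L : Set E)) = 2) : IsRankTwo (𝓞 K) L := by
  classical
  let W := Submodule.span K (L : Set E)
  have : Module.Finite K W := Module.finite_of_finrank_pos (hrank ▸ two_pos)
  let b : Module.Basis (Fin 2) K W := Module.finBasisOfFinrankEq K W hrank
  let incl : L →ₗ[𝓞 K] W :=
    LinearMap.codRestrict (W.restrictScalars (𝓞 K)) L.subtype fun m => Submodule.subset_span m.2
  obtain ⟨s, hs⟩ := Module.finite_def.mp (Module.Finite.iff_fg.mpr hfg)
  obtain ⟨⟨d, hd⟩, hds⟩ := IsLocalization.exist_integer_multiples_of_finset (𝓞 K)⁰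
    (s.image (fun m => b.coord 0 (incl m)) ∪ s.image (fun m => b.coord 1 (incl m)))
  have hd0 : (d : K) ≠ 0 := by simpa using nonZeroDivisors.ne_zero hd
  have main : ∀ i, ∃ α : L →ₗ[𝓞 K] 𝓞 K, ∀ m, (α m : K) = d * b.coord i (incl m) := by
    intro i
    let g : L →ₗ[𝓞 K] K := d • ((b.coord i).restrictScalars (𝓞 K) ∘ₗ incl)
    have hg : ∀ m, g m ∈ LinearMap.range (Algebra.linearMap (𝓞 K) K) := by
      intro m
      have hm : m ∈ Submodule.span (𝓞 K) (s : Set L) := hs ▸ Submodule.mem_top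
      rw [← Submodule.mem_comap]
      refine Submodule.span_le.mpr ?_ hm
      intro m hm
      obtain ⟨z, hz⟩ := hds (b.coord i (incl m)) (by
        have := Finset.mem_coe.mp hm
        fin_cases i
        · exact Finset.mem_union_left _ (Finset.mem_image_of_mem _ this)
        · exact Finset.mem_union_right _ (Finset.mem_image_of_mem _ this))
      exact ⟨z, hz⟩
    have hinj : Function.Injective (Algebra.linearMap (𝓞 K) K) :=
      FaithfulSMul.algebraMap_injective (𝓞 K) K
    refine ⟨(LinearEquiv.ofInjective _ hinj).symm.toLinearMap ∘ₗ LinearMap.codRestrict _ g hg,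
      fun m => ?_⟩
    have h1 := LinearEquiv.apply_symm_apply (LinearEquiv.ofInjective _ hinj)
      (LinearMap.codRestrict _ g hg m)
    have h2 := congrArg Subtype.val h1
    refine h2.trans ?_
    simp [g, Algebra.smul_def]
  obtain ⟨α, hα⟩ := main 0
  obtain ⟨β, hβ⟩ := main 1
  refine ⟨α, β, fun m h1 h2 => ?_, ?_⟩
  · have h1' := hα m
    have h2' := hβ m
    rw [h1] at h1'
    rw [h2] at h2'
    have e0 : b.coord 0 (incl m) = 0 := by simpa [hd0] using h1'.symm
    have e1 : b.coord 1 (incl m) = 0 := by simpa [hd0] using h2'.symm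
    have : incl m = 0 := b.forall_coord_eq_zero_iff.mp (by
      intro i; fin_cases i
      · exact e0
      · exact e1)
    exact Subtype.ext (congrArg (fun w : W => (w : E)) this)
  · by_contra hcon
    push Not at hcon
    -- If all minors vanished, the coordinate functionals would satisfy a linear relation on the
    -- lattice, hence on its span. Evaluating it at `b 1` kills coordinate 0 altogether, which is
    -- absurd at `b 0`.
    have ext_zero : ∀ f : W →ₗ[K] K, (∀ m, f (incl m) = 0) → f = 0 := by
      intro f hf
      have htop : Submodule.span K (Set.range incl) = ⊤ := by
        have hmap : Submodule.map W.subtype (Submodule.span K (Set.range incl)) =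
            Submodule.map W.subtype ⊤ := by
          rw [Submodule.map_span, Submodule.map_top, Submodule.range_subtype]
          congr 1
          ext x
          constructor
          · rintro ⟨_, ⟨m, rfl⟩, rfl⟩; exact m.2
          · intro hx; exact ⟨_, ⟨⟨x, hx⟩, rfl⟩, rfl⟩
        exact Submodule.map_injective_of_injective W.subtype_injective hmap
      refine LinearMap.ext_on htop ?_
      rintro _ ⟨m, rfl⟩
      exact hf m
    have hK : ∀ p q : L, b.coord 0 (incl p) * b.coord 1 (incl q) -
        b.coord 0 (incl q) * b.coord 1 (incl p) = 0 := by
      intro p q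
      have h := congrArg (algebraMap (𝓞 K) K) (hcon p q)
      simp only [map_sub, map_mul, map_zero] at h
      rw [show algebraMap (𝓞 K) K (α p) = _ from hα p, show algebraMap (𝓞 K) K (α q) = _ from hα q,
        show algebraMap (𝓞 K) K (β p) = _ from hβ p,
        show algebraMap (𝓞 K) K (β q) = _ from hβ q] at h
      refine (mul_eq_zero.mp (show ((d : K) * d) * _ = 0 from ?_)).resolve_left
        (mul_ne_zero hd0 hd0)
      linear_combination h
    have h1 : ∀ p : L, b.coord 0 (incl p) • b.coord 1 - b.coord 1 (incl p) • b.coord 0 = 0 :=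
      fun p => ext_zero _ fun q => by
        have := hK p q
        simp only [LinearMap.sub_apply, LinearMap.smul_apply, smul_eq_mul]
        linear_combination this
    have h2 : b.coord 0 = 0 := ext_zero _ fun p => by
      have := LinearMap.congr_fun (h1 p) (b 1)
      simpa using this
    have := LinearMap.congr_fun h2 (b 0)
    simp at this

theorem IsLattice.isRankTwo {L : Submodule (𝓞 K) (Row K)} (hL : IsLattice L) :
    IsRankTwo (𝓞 K) L :=
  isRankTwo_of_fg L hL.fg hL.rank_two

/-- For lattices the default value in `steinitzClass` never occurs. -/
theorem hasClass_steinitzClass {L : Submodule (𝓞 K) (Row K)} (hL : IsLattice L) :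
    HasClass (𝓞 K) L (steinitzClass L) := by
  have h : ∃ c, HasSteinitzClass L c := by
    obtain ⟨C, hC⟩ := hL.isRankTwo.exists_equiv
    exact ⟨_, C, rfl, hC⟩
  rw [steinitzClass, dif_pos h]
  obtain ⟨C, hC, ⟨e⟩⟩ := h.choose_spec
  rw [← hC]
  exact HasClass.of_equiv_prod e

/-- The kernel of the projection to `𝓞 K ⧸ I₂` lies between `L` and `M`. Both steps have cyclic
quotients, so the cyclic case applies twice. -/
theorem HasClass.of_hasIndexIdeal {M L : Submodule (𝓞 K) (Row K)} {I : (Ideal (𝓞 K))⁰}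
    {c : ClassGroup (𝓞 K)} (hM : HasClass (𝓞 K) M c) (h : HasIndexIdeal M L I) :
    HasClass (𝓞 K) L (ClassGroup.mk0 I * c) := by
  obtain ⟨hle, I₁, I₂, -, hI, ⟨e⟩⟩ := h
  have h0 : I₁ * I₂ ≠ 0 := hI ▸ nonZeroDivisors.coe_ne_zero I
  let J₁ : (Ideal (𝓞 K))⁰ := ⟨I₁, mem_nonZeroDivisors_of_ne_zero (left_ne_zero_of_mul h0)⟩
  let J₂ : (Ideal (𝓞 K))⁰ := ⟨I₂, mem_nonZeroDivisors_of_ne_zero (right_ne_zero_of_mul h0)⟩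
  have hJ : I = J₁ * J₂ := Subtype.ext hI.symm
  let π : M →ₗ[𝓞 K] (𝓞 K ⧸ I₁) × (𝓞 K ⧸ I₂) := e.toLinearMap ∘ₗ (L.submoduleOf M).mkQ
  have hπ : Function.Surjective π := e.surjective.comp (Submodule.mkQ_surjective _)
  have hπk : ∀ m : M, π m = 0 ↔ (m : Row K) ∈ L := by
    intro m
    rw [LinearMap.comp_apply, LinearEquiv.coe_coe, LinearEquiv.map_eq_zero_iff,
      Submodule.mkQ_apply, Submodule.Quotient.mk_eq_zero]
    exact Submodule.mem_comap
  let π₂ : M →ₗ[𝓞 K] 𝓞 K ⧸ I₂ := LinearMap.snd _ _ _ ∘ₗ π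
  have hN := hM.ker J₂ π₂ (Prod.snd_surjective.comp hπ)
  let π₁ : LinearMap.ker π₂ →ₗ[𝓞 K] 𝓞 K ⧸ I₁ :=
    LinearMap.fst _ _ _ ∘ₗ π ∘ₗ (LinearMap.ker π₂).subtype
  rw [hJ, map_mul, mul_assoc]
  refine hN.of_exact J₁ (LinearMap.codRestrict _ (Submodule.inclusion hle) fun x =>
      congrArg Prod.snd ((hπk _).mpr x.2)) (fun x y hxy => ?_) π₁ (fun x => ?_) (fun x => ?_)
  · exact Subtype.ext (congrArg (fun z : LinearMap.ker π₂ => ((z : M) : Row K)) hxy)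
  · obtain ⟨m, hm⟩ := hπ (x, 0)
    exact ⟨⟨m, congrArg Prod.snd hm⟩, congrArg Prod.fst hm⟩
  · constructor
    · intro hx
      have hx' : π x.1 = 0 := Prod.ext hx x.2
      exact ⟨⟨x.1.1, (hπk _).mp hx'⟩, rfl⟩
    · rintro ⟨y, rfl⟩
      exact congrArg Prod.fst ((hπk _).mpr y.2)

theorem mem_fracMul_of_mem {I : FractionalIdeal (𝓞 K)⁰ K} {L : Submodule (𝓞 K) (Row K)} {a : K}
    {x : Row K} (ha : a ∈ I) (hx : x ∈ L) : a • x ∈ fracMul I L :=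
  Submodule.subset_span ⟨a, ha, x, hx, rfl⟩

theorem fracMul_le {I : FractionalIdeal (𝓞 K)⁰ K} {L N : Submodule (𝓞 K) (Row K)} :
    fracMul I L ≤ N ↔ ∀ a ∈ I, ∀ x ∈ L, a • x ∈ N := by
  rw [fracMul, Submodule.span_le]
  exact ⟨fun h a ha x hx => h ⟨a, ha, x, hx, rfl⟩,
    fun h y ⟨a, ha, x, hx, hy⟩ => hy ▸ h a ha x hx⟩

theorem fracMul_mono (I : FractionalIdeal (𝓞 K)⁰ K) {L N : Submodule (𝓞 K) (Row K)}
    (h : L ≤ N) : fracMul I L ≤ fracMul I N :=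
  fracMul_le.mpr fun _ ha _ hx => mem_fracMul_of_mem ha (h hx)

theorem fracMul_one (L : Submodule (𝓞 K) (Row K)) : fracMul 1 L = L := by
  refine le_antisymm (fracMul_le.mpr fun a ha x hx => ?_) fun x hx => ?_
  · obtain ⟨r, rfl⟩ := (FractionalIdeal.mem_one_iff _).mp ha
    rw [algebraMap_smul]
    exact L.smul_mem r hx
  · simpa using mem_fracMul_of_mem (FractionalIdeal.one_mem_one (𝓞 K)⁰) hx

/-- Multiplication by an element of the field, as a map of `𝓞 K`-modules. -/
def smulMap (x : K) : Row K →ₗ[𝓞 K] Row K :=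
  (LinearMap.lsmul K (Row K) x).restrictScalars (𝓞 K)

theorem fracMul_mul (I J : FractionalIdeal (𝓞 K)⁰ K) (L : Submodule (𝓞 K) (Row K)) :
    fracMul (I * J) L = fracMul I (fracMul J L) := by
  refine le_antisymm (fracMul_le.mpr fun a ha x hx => ?_) (fracMul_le.mpr fun a ha x hx => ?_)
  · refine FractionalIdeal.mul_induction_on ha (fun i hi j hj => ?_) (fun y z hy hz => ?_)
    · rw [mul_smul]
      exact mem_fracMul_of_mem hi (mem_fracMul_of_mem hj hx)
    · rw [add_smul]
      exact Submodule.add_mem _ hy hz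
  · have : fracMul J L ≤ (fracMul (I * J) L).comap (smulMap a) :=
      fracMul_le.mpr fun b hb y hy => by
        have h := mem_fracMul_of_mem (FractionalIdeal.mul_mem_mul ha hb) hy
        rwa [mul_smul] at h
    exact this hx

theorem smulMap_injective {x : K} (hx : x ≠ 0) : Function.Injective (smulMap x) :=
  smul_right_injective (Row K) hx

/-- Reduces fractional ideals to integral ones: for `x ≠ 0` the map `smulMap x` is injective and
does not change the class. -/
theorem fracMul_spanSingleton_mul (x : K) (J : Ideal (𝓞 K)) (L : Submodule (𝓞 K) (Row K)) :
    fracMul (FractionalIdeal.spanSingleton (𝓞 K)⁰ x * (J : FractionalIdeal (𝓞 K)⁰ K)) L =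
      (J • L).map (smulMap x) := by
  refine le_antisymm (fracMul_le.mpr fun a ha y hy => ?_) ?_
  · obtain ⟨z, hz, rfl⟩ := FractionalIdeal.mem_singleton_mul.mp ha
    obtain ⟨j, hj, rfl⟩ := (FractionalIdeal.mem_coeIdeal _).mp hz
    refine ⟨j • y, Submodule.smul_mem_smul hj hy, ?_⟩
    change x • j • y = _
    rw [mul_smul, algebraMap_smul]
  · rw [Submodule.map_le_iff_le_comap, Submodule.smul_le]
    intro j hj y hy
    have hm : x * algebraMap (𝓞 K) K j ∈
        FractionalIdeal.spanSingleton (𝓞 K)⁰ x * (J : FractionalIdeal (𝓞 K)⁰ K) :=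
      FractionalIdeal.mem_singleton_mul.mpr
        ⟨_, (FractionalIdeal.mem_coeIdeal _).mpr ⟨j, hj, rfl⟩, rfl⟩
    have h := mem_fracMul_of_mem hm hy
    rwa [mul_smul, algebraMap_smul] at h

theorem exists_eq_spanSingleton_mul_mk0 (I : FracIdeals K) : ∃ (x : K) (J : (Ideal (𝓞 K))⁰),
    x ≠ 0 ∧ ClassGroup.mk (K := K) I = ClassGroup.mk0 J ∧
    (I : FractionalIdeal (𝓞 K)⁰ K) =
      FractionalIdeal.spanSingleton (𝓞 K)⁰ x * ((J : Ideal (𝓞 K)) : FractionalIdeal (𝓞 K)⁰ K) := by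
  obtain ⟨a, J, ha, hI⟩ := FractionalIdeal.exists_eq_spanSingleton_mul
    (I : FractionalIdeal (𝓞 K)⁰ K)
  have hx : (algebraMap (𝓞 K) K a)⁻¹ ≠ 0 := inv_ne_zero (by simpa using ha)
  have hJ : J ≠ 0 := by
    rintro rfl
    refine I.ne_zero ?_
    rw [hI]
    simp
  let J₀ : (Ideal (𝓞 K))⁰ := ⟨J, mem_nonZeroDivisors_of_ne_zero hJ⟩
  refine ⟨_, J₀, hx, ?_, hI⟩
  have : I = toPrincipalIdeal (𝓞 K) K (Units.mk0 _ hx) * FractionalIdeal.mk0 K J₀ :=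
    Units.ext (by
      rw [hI, Units.val_mul, coe_toPrincipalIdeal, FractionalIdeal.coe_mk0]; rfl)
  rw [this, map_mul, ClassGroup.mk_mk0]
  convert! one_mul _
  rw [ClassGroup.mk_eq_one_iff]
  exact ⟨⟨_, by rw [coe_toPrincipalIdeal, FractionalIdeal.coe_spanSingleton]⟩⟩

/-- The class of `I L`. -/
theorem HasClass.fracMul {L : Submodule (𝓞 K) (Row K)} {c : ClassGroup (𝓞 K)}
    (h : HasClass (𝓞 K) L c) (I : FracIdeals K) :
    HasClass (𝓞 K) (fracMul (I : FractionalIdeal (𝓞 K)⁰ K) L)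
      (ClassGroup.mk (K := K) I ^ 2 * c) := by
  obtain ⟨x, J, hx, hJ, hI⟩ := exists_eq_spanSingleton_mul_mk0 I
  rw [hI, fracMul_spanSingleton_mul, hJ]
  have hJL : (J : Ideal (𝓞 K)) • L =
      Submodule.map L.subtype ((J : Ideal (𝓞 K)) • (⊤ : Submodule (𝓞 K) L)) := by
    rw [Submodule.map_smul'', Submodule.map_top, Submodule.range_subtype]
  exact (h.smul_top J).of_linearEquiv
    (((Submodule.equivMapOfInjective (smulMap x) (smulMap_injective hx)
      ((J : Ideal (𝓞 K)) • L)).symm.trans (LinearEquiv.ofEq _ _ hJL)).trans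
    (Submodule.equivMapOfInjective L.subtype L.subtype_injective _).symm)

/-- The ring `S` is general so as to cover both `K ⊗ ℝ` (spanning) and `K` (rank). -/
theorem span_fracMul_le {S : Type*} [Semiring S] [Algebra K S] [Module S (Row K)]
    [IsScalarTower K S (Row K)] (I : FractionalIdeal (𝓞 K)⁰ K) (L : Submodule (𝓞 K) (Row K)) :
    Submodule.span S (fracMul I L : Set (Row K)) ≤ Submodule.span S (L : Set (Row K)) := by
  let N : Submodule (𝓞 K) (Row K) :=
    ((Submodule.span S (L : Set (Row K))).restrictScalars K).restrictScalars (𝓞 K)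
  have h : fracMul I L ≤ N := fracMul_le.mpr fun a _ x hx =>
    Submodule.smul_mem ((Submodule.span S (L : Set (Row K))).restrictScalars K) a
      (Submodule.subset_span hx)
  exact Submodule.span_le.mpr h

theorem fracMul_inv_fracMul (I : FracIdeals K) (L : Submodule (𝓞 K) (Row K)) :
    fracMul ((I⁻¹ : FracIdeals K) : FractionalIdeal (𝓞 K)⁰ K)
      (fracMul (I : FractionalIdeal (𝓞 K)⁰ K) L) = L := by
  rw [← fracMul_mul, ← Units.val_mul, inv_mul_cancel, Units.val_one, fracMul_one]

theorem span_fracMul {S : Type*} [Semiring S] [Algebra K S] [Module S (Row K)]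
    [IsScalarTower K S (Row K)] (I : FracIdeals K) (L : Submodule (𝓞 K) (Row K)) :
    Submodule.span S (fracMul (I : FractionalIdeal (𝓞 K)⁰ K) L : Set (Row K)) =
      Submodule.span S (L : Set (Row K)) := by
  refine le_antisymm (span_fracMul_le _ L) ?_
  conv_lhs => rw [← fracMul_inv_fracMul I L]
  exact span_fracMul_le _ _

theorem IsLattice.fracMul {L : Submodule (𝓞 K) (Row K)} (hL : IsLattice L) (I : FracIdeals K) :
    IsLattice (fracMul (I : FractionalIdeal (𝓞 K)⁰ K) L) where
  span_eq_top := by rw [span_fracMul, hL.span_eq_top]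
  rank_two := by rw [span_fracMul, hL.rank_two]
  fg := by
    obtain ⟨x, J, -, -, hI⟩ := exists_eq_spanSingleton_mul_mk0 I
    rw [hI, fracMul_spanSingleton_mul]
    exact (hL.fg.of_le Submodule.smul_le_right).map _

theorem steinitzClass_eq {L : Submodule (𝓞 K) (Row K)} (hL : IsLattice L)
    {c : ClassGroup (𝓞 K)} (h : HasClass (𝓞 K) L c) : steinitzClass L = c :=
  (hasClass_steinitzClass hL).unique h

end Lattices

/-! ### The operators `T_{𝔞,𝔞}` and the classes of the Hecke operators. -/

section Scaling

variable {K : Type*} [Field K] [NumberField K] {n : Ideal (𝓞 K)}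

/-- The class of `b` generates `L' / L`. -/
def GeneratesMod (L L' : Submodule (𝓞 K) (Row K)) (b : Row K) : Prop :=
  b ∈ L' ∧ ∀ z ∈ L', ∃ r : 𝓞 K, z - r • b ∈ L

theorem generatesMod_iff {L L' : Submodule (𝓞 K) (Row K)} {b : Row K}
    (hb : b ∈ L') :
    GeneratesMod L L' b ↔
      Submodule.span (𝓞 K) {(Submodule.Quotient.mk b : Row K ⧸ L)} = L'.map L.mkQ := by
  constructor
  · rintro ⟨-, h⟩
    refine le_antisymm ?_ ?_
    · rw [Submodule.span_singleton_le_iff_mem]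
      exact ⟨b, hb, rfl⟩
    · rintro _ ⟨z, hz, rfl⟩
      obtain ⟨r, hr⟩ := h z hz
      exact Submodule.mem_span_singleton.mpr ⟨r, ((Submodule.Quotient.eq L).mpr hr).symm⟩
  · intro h
    refine ⟨hb, fun z hz => ?_⟩
    have hz' : L.mkQ z ∈ Submodule.span (𝓞 K) {(Submodule.Quotient.mk b : Row K ⧸ L)} :=
      h ▸ Submodule.mem_map_of_mem hz
    obtain ⟨r, hr⟩ := Submodule.mem_span_singleton.mp hz'
    exact ⟨r, (Submodule.Quotient.eq L).mp hr.symm⟩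

theorem ModularPoint₀.smul_mem (P : ModularPoint₀ n) {r : 𝓞 K} (hr : r ∈ n) {z : Row K}
    (hz : z ∈ P.L') : r • z ∈ P.L := by
  obtain ⟨e⟩ := P.cyclic
  have h : (P.L.submoduleOf P.L').mkQ (r • ⟨z, hz⟩) = 0 := by
    apply e.injective
    rw [map_smul, map_smul, map_zero]
    obtain ⟨t, ht⟩ := Ideal.Quotient.mk_surjective (e ((P.L.submoduleOf P.L').mkQ ⟨z, hz⟩))
    rw [← ht]
    exact Ideal.Quotient.eq_zero_iff_mem.mpr (n.mul_mem_right t hr)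
  exact (Submodule.Quotient.mk_eq_zero (P.L.submoduleOf P.L')).mp h

theorem ModularPoint₀.mem_of_smul_mem (P : ModularPoint₀ n) {b : Row K}
    (hb : GeneratesMod P.L P.L' b) {r : 𝓞 K} (hr : r • b ∈ P.L) : r ∈ n := by
  obtain ⟨e⟩ := P.cyclic
  obtain ⟨m, hm⟩ := Submodule.mkQ_surjective _ (e.symm 1)
  obtain ⟨t, ht⟩ := hb.2 m m.2
  have h1 : r • (m : Row K) ∈ P.L := by
    have : r • (m : Row K) = r • ((m : Row K) - t • b) + t • r • b := by
      rw [smul_sub, smul_comm r t b, sub_add_cancel]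
    rw [this]
    exact P.L.add_mem (P.L.smul_mem r ht) (P.L.smul_mem t hr)
  have h2 : r • (P.L.submoduleOf P.L').mkQ m = 0 :=
    (Submodule.Quotient.mk_eq_zero (P.L.submoduleOf P.L')).mpr (show r • m ∈ _ from h1)
  have h3 := congrArg e h2
  rw [map_smul, hm, LinearEquiv.apply_symm_apply, map_zero] at h3
  have h4 : Ideal.Quotient.mk n (r * 1) = 0 := h3
  rwa [mul_one, Ideal.Quotient.eq_zero_iff_mem] at h4

theorem ModularPoint₀.exists_generatesMod (P : ModularPoint₀ n) :
    ∃ b, GeneratesMod P.L P.L' b := by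
  obtain ⟨e⟩ := P.cyclic
  obtain ⟨m, hm⟩ := Submodule.mkQ_surjective _ (e.symm 1)
  refine ⟨m, m.2, fun z hz => ?_⟩
  obtain ⟨t, ht⟩ := Ideal.Quotient.mk_surjective (e ((P.L.submoduleOf P.L').mkQ ⟨z, hz⟩))
  refine ⟨t, ?_⟩
  have h : (P.L.submoduleOf P.L').mkQ (⟨z, hz⟩ - t • m) = 0 := by
    apply e.injective
    rw [map_sub, map_sub, map_smul, map_smul, hm, LinearEquiv.apply_symm_apply, ← ht, map_zero,
      sub_eq_zero]
    change Ideal.Quotient.mk n t = Ideal.Quotient.mk n (t * 1)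
    rw [mul_one]
  exact (Submodule.Quotient.mk_eq_zero (P.L.submoduleOf P.L')).mp h

theorem nonempty_quotient_equiv {L L' : Submodule (𝓞 K) (Row K)} {b : Row K}
    (hb : GeneratesMod L L' b) (hn : ∀ r : 𝓞 K, r • b ∈ L ↔ r ∈ n) :
    Nonempty ((L' ⧸ L.submoduleOf L') ≃ₗ[𝓞 K] (𝓞 K ⧸ n)) := by
  let f : 𝓞 K →ₗ[𝓞 K] L' ⧸ L.submoduleOf L' :=
    LinearMap.toSpanSingleton (𝓞 K) _ ((L.submoduleOf L').mkQ ⟨b, hb.1⟩)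
  have hf : Function.Surjective f := by
    intro y
    obtain ⟨z, rfl⟩ := Submodule.mkQ_surjective _ y
    obtain ⟨r, hr⟩ := hb.2 z z.2
    exact ⟨r, ((Submodule.Quotient.eq (L.submoduleOf L')).mpr hr).symm⟩
  have hk : LinearMap.ker f = n := by
    ext r
    rw [LinearMap.mem_ker, ← hn]
    exact Submodule.Quotient.mk_eq_zero (L.submoduleOf L') (x := r • ⟨b, hb.1⟩)
  exact ⟨((Submodule.quotEquivOfEq _ _ hk.symm).trans (f.quotKerEquivOfSurjective hf)).symm⟩

/-- `I` contains an integer that is congruent to one modulo `n`. -/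
def HasUnitRep (n : Ideal (𝓞 K)) (I : FracIdeals K) : Prop :=
  ∃ x : 𝓞 K, (x : K) ∈ (I : FractionalIdeal (𝓞 K)⁰ K) ∧ 1 - x ∈ n

/-- Such integers act as the identity on `L' / L`, while moving vectors between `L'` and `I⁻¹ L'`.
Both halves are proved together because the inverse step of the closure induction swaps them. -/
theorem hasUnitRep_of_mem_coprimeIdeals {I : FracIdeals K} (hI : I ∈ coprimeIdeals n) :
    HasUnitRep n I ∧ HasUnitRep n I⁻¹ := by
  have hmul : ∀ {I J : FracIdeals K}, HasUnitRep n I → HasUnitRep n J → HasUnitRep n (I * J) := by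
    rintro I J ⟨x, hx, hx'⟩ ⟨y, hy, hy'⟩
    refine ⟨x * y, ?_, ?_⟩
    · rw [Units.val_mul, show ((x * y : 𝓞 K) : K) = x * y from map_mul _ _ _]
      exact FractionalIdeal.mul_mem_mul hx hy
    · have : 1 - x * y = (1 - x) + x * (1 - y) := by ring
      rw [this]
      exact n.add_mem hx' (n.mul_mem_left x hy')
  induction hI using Subgroup.closure_induction with
  | mem I hI =>
    obtain ⟨A, hA, hIA⟩ := hI
    constructor
    · obtain ⟨x, hx, y, hy, hxy⟩ := Ideal.isCoprime_iff_exists.mp hA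
      refine ⟨x, ?_, ?_⟩
      · rw [hIA]
        exact FractionalIdeal.mem_coeIdeal_of_mem _ hx
      · rwa [← hxy, add_sub_cancel_left]
    · refine ⟨1, ?_, by simp⟩
      have hle : (I : FractionalIdeal (𝓞 K)⁰ K) ≤ 1 := hIA ▸ FractionalIdeal.coeIdeal_le_one
      have h1 : (1 : FractionalIdeal (𝓞 K)⁰ K) ≤ (I⁻¹ : FracIdeals K) := by
        calc (1 : FractionalIdeal (𝓞 K)⁰ K) = I * (I⁻¹ : FracIdeals K) := by
              rw [← Units.val_mul, mul_inv_cancel, Units.val_one]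
          _ ≤ 1 * (I⁻¹ : FracIdeals K) := mul_le_mul_left hle _
          _ = _ := one_mul _
      rw [show ((1 : 𝓞 K) : K) = 1 from map_one _]
      exact h1 (FractionalIdeal.one_mem_one _)
  | one => exact ⟨⟨1, by simp, by simp⟩,
      ⟨1, by simp, by simp⟩⟩
  | mul I J _ _ hI hJ => exact ⟨hmul hI.1 hJ.1, by rw [mul_inv]; exact hmul hI.2 hJ.2⟩
  | inv I _ hI => exact ⟨hI.2, by rw [inv_inv]; exact hI.1⟩

variable {I : FracIdeals K}

/-- The lattice `I⁻¹ L`. -/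
abbrev invMul (I : FracIdeals K) (L : Submodule (𝓞 K) (Row K)) : Submodule (𝓞 K) (Row K) :=
  fracMul ((I⁻¹ : FracIdeals K) : FractionalIdeal (𝓞 K)⁰ K) L

theorem smul_mem_invMul {x : 𝓞 K}
    (hx : (x : K) ∈ ((I⁻¹ : FracIdeals K) : FractionalIdeal (𝓞 K)⁰ K))
    {L : Submodule (𝓞 K) (Row K)} {z : Row K} (hz : z ∈ L) : x • z ∈ invMul I L := by
  have := mem_fracMul_of_mem hx hz
  rwa [show (x : K) = algebraMap (𝓞 K) K x from rfl, algebraMap_smul] at this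

theorem smul_mem_of_mem_invMul {x : 𝓞 K} (hx : (x : K) ∈ (I : FractionalIdeal (𝓞 K)⁰ K))
    {L : Submodule (𝓞 K) (Row K)} {z : Row K} (hz : z ∈ invMul I L) : x • z ∈ L := by
  have := mem_fracMul_of_mem hx hz
  rwa [← fracMul_mul, ← Units.val_mul, mul_inv_cancel, Units.val_one, fracMul_one,
    show (x : K) = algebraMap (𝓞 K) K x from rfl, algebraMap_smul] at this

theorem ModularPoint₀.smul_mem_invMul (P : ModularPoint₀ n) {r : 𝓞 K} (hr : r ∈ n) {z : Row K}
    (hz : z ∈ invMul I P.L') : r • z ∈ invMul I P.L := by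
  have h : invMul I P.L' ≤ (invMul I P.L).comap (LinearMap.lsmul (𝓞 K) (Row K) r) :=
    fracMul_le.mpr fun a ha x hx => by
      have := mem_fracMul_of_mem ha (P.smul_mem hr hx)
      rwa [smul_comm] at this
  exact h hz

/-- Multiplication by `y` maps `L' / L` to `I⁻¹ L' / I⁻¹ L`, multiplication by `x` maps back, and `x
* y` is 1 modulo `n`, which kills both quotients. -/
theorem ModularPoint₀.generatesMod_invMul (P : ModularPoint₀ n) {b : Row K}
    (hb : GeneratesMod P.L P.L' b) {x y : 𝓞 K} (hx : (x : K) ∈ (I : FractionalIdeal (𝓞 K)⁰ K))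
    (hy : (y : K) ∈ ((I⁻¹ : FracIdeals K) : FractionalIdeal (𝓞 K)⁰ K)) (hxn : 1 - x ∈ n)
    (hyn : 1 - y ∈ n) :
    GeneratesMod (invMul I P.L) (invMul I P.L') (y • b) ∧
      ∀ r : 𝓞 K, r • y • b ∈ invMul I P.L ↔ r ∈ n := by
  have hxy : 1 - x * y ∈ n := by
    have : 1 - x * y = (1 - x) + x * (1 - y) := by ring
    rw [this]
    exact n.add_mem hxn (n.mul_mem_left x hyn)
  refine ⟨⟨HeckePoints.smul_mem_invMul hy hb.1, fun z hz => ?_⟩, fun r => ⟨fun hr => ?_, fun hr =>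
    P.smul_mem_invMul hr (HeckePoints.smul_mem_invMul hy hb.1)⟩⟩
  · obtain ⟨r, hr⟩ := hb.2 _ (smul_mem_of_mem_invMul hx hz)
    refine ⟨r, ?_⟩
    have : z - r • y • b = (1 - x * y) • z + y • (x • z - r • b) := by module
    rw [this]
    exact Submodule.add_mem _ (P.smul_mem_invMul hxy hz) (HeckePoints.smul_mem_invMul hy hr)
  · refine P.mem_of_smul_mem hb ?_
    have : r • b = (1 - x * y) • r • b + x • r • y • b := by module
    rw [this]
    exact P.L.add_mem (P.smul_mem hxy (P.L'.smul_mem r hb.1)) (smul_mem_of_mem_invMul hx hr)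

/-- Makes the generator of a scaled point independent of the representative in `L' ∩ I⁻¹ L'`. -/
theorem ModularPoint₀.mem_invMul (P : ModularPoint₀ n) (hI : HasUnitRep n I⁻¹) {b : Row K}
    (hb : b ∈ P.L) (hb' : b ∈ invMul I P.L') : b ∈ invMul I P.L := by
  obtain ⟨y, hy, hyn⟩ := hI
  have : b = (1 - y) • b + y • b := by module
  rw [this]
  exact Submodule.add_mem _ (P.smul_mem_invMul hyn hb') (HeckePoints.smul_mem_invMul hy hb)

/-- The modular point `(I⁻¹ L, I⁻¹ L')`. -/
def ModularPoint₀.scale (P : ModularPoint₀ n) (hI : I ∈ coprimeIdeals n) : ModularPoint₀ n where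
  L := invMul I P.L
  L' := invMul I P.L'
  isLattice := P.isLattice.fracMul I⁻¹
  isLattice' := P.isLattice'.fracMul I⁻¹
  le := fracMul_mono _ P.le
  cyclic := by
    obtain ⟨⟨x, hx, hxn⟩, y, hy, hyn⟩ := hasUnitRep_of_mem_coprimeIdeals hI
    obtain ⟨b, hb⟩ := P.exists_generatesMod
    obtain ⟨h1, h2⟩ := P.generatesMod_invMul hb hx hy hxn hyn
    exact nonempty_quotient_equiv h1 h2

theorem existsUnique_isScaledBy {Γ : LevelKind} (hI : I ∈ coprimeIdeals n)
    (P : ModularPoint n Γ) : ∃! Q, IsScaledBy I P Q := by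
  cases Γ with
  | gamma0 =>
    refine ⟨ModularPoint₀.scale P hI, ⟨rfl, rfl, trivial⟩, fun Q hQ => ?_⟩
    exact ModularPoint₀.ext hQ.1 hQ.2.1
  | gamma1 =>
    obtain ⟨P₀, β, hβ⟩ := P
    obtain ⟨⟨x, hx, hxn⟩, y, hy, hyn⟩ := hasUnitRep_of_mem_coprimeIdeals hI
    have hβ' : β ∈ P₀.L'.map P₀.L.mkQ := hβ ▸ Submodule.mem_span_singleton_self β
    obtain ⟨b, hb, rfl⟩ := hβ'
    have hgen := (generatesMod_iff hb).mpr hβ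
    have h1 := (P₀.generatesMod_invMul hgen hx hy hxn hyn).1
    -- As `y` is 1 modulo `n`, the vector `y • b` still represents `β`, and it lies in `I⁻¹ L'`.
    let Q : ModularPoint₁ n :=
      { P₀.scale hI with
        β := Submodule.Quotient.mk (y • b)
        generates := (generatesMod_iff h1.1).mp h1 }
    refine ⟨Q, ⟨rfl, rfl, y • b, P₀.L'.smul_mem y hb, h1.1, ?_, rfl⟩, ?_⟩
    · refine (Submodule.Quotient.eq P₀.L).mpr ?_
      have : y • b - b = -((1 - y) • b) := by module
      rw [this]
      exact P₀.L.neg_mem (P₀.smul_mem hyn hb)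
    · rintro ⟨⟨L, L', h2, h3, h4, h5⟩, γ, hγ⟩ ⟨hL, hL', b', hb', hb'', hm, hm'⟩
      change L = invMul I P₀.L at hL
      change L' = invMul I P₀.L' at hL'
      subst hL hL'
      have hγ' : γ = Submodule.Quotient.mk (y • b) := by
        refine hm'.symm.trans ((Submodule.Quotient.eq _).mpr ?_)
        refine P₀.mem_invMul ⟨y, hy, hyn⟩ ?_ (Submodule.sub_mem _ hb'' h1.1)
        have h6 : b' - b ∈ P₀.L := (Submodule.Quotient.eq _).mp hm
        have : b' - y • b = (b' - b) + (1 - y) • b := by module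
        rw [this]
        exact P₀.L.add_mem h6 (P₀.smul_mem hyn hb)
      subst hγ'
      rfl

theorem ModularPoint.SameGenerator.symm {Γ : LevelKind} {P Q : ModularPoint n Γ}
    (h : P.SameGenerator Q) : Q.SameGenerator P := by
  cases Γ with
  | gamma0 => trivial
  | gamma1 =>
    obtain ⟨b, h1, h2, h3, h4⟩ := h
    exact ⟨b, h2, h1, h4, h3⟩

theorem IsScaledBy.symm {Γ : LevelKind} {P Q : ModularPoint n Γ} (h : IsScaledBy I P Q) :
    IsScaledBy I⁻¹ Q P := by
  refine ⟨?_, ?_, h.2.2.symm⟩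
  · rw [h.1, fracMul_inv_fracMul]
  · rw [h.2.1, fracMul_inv_fracMul]

theorem opTT_single {Γ : LevelKind} (hI : I ∈ coprimeIdeals n) {P Q : ModularPoint n Γ}
    (h : IsScaledBy I P Q) :
    opTT n Γ I (Finsupp.single P 1) =
      ((FractionalIdeal.absNorm (I : FractionalIdeal (𝓞 K)⁰ K)) ^ 2)⁻¹ • Finsupp.single Q 1 := by
  have hset : {Q : ModularPoint n Γ | IsScaledBy I P Q} = {Q} :=
    Set.ext fun Q' => ⟨fun h' => (existsUnique_isScaledBy hI P).unique h' h, fun h' => h' ▸ h⟩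
  rw [opTT, Finsupp.linearCombination_single, one_smul, hset, finsum_mem_singleton]

/-- Invertibility is what prevents an eigensystem from vanishing on `T_{𝔞,𝔞}`. -/
theorem heckeTT_mul_inv (n : Ideal (𝓞 K)) (Γ : LevelKind) (I : coprimeIdeals n) :
    heckeTT n Γ I⁻¹ * heckeTT n Γ I = 1 := by
  refine Subtype.ext (Finsupp.lhom_ext' fun P => LinearMap.ext_ring ?_)
  obtain ⟨Q, hQ, -⟩ := existsUnique_isScaledBy I.2 P
  change opTT n Γ (I.1)⁻¹ (opTT n Γ I.1 (Finsupp.single P 1)) = Finsupp.single P 1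
  rw [opTT_single I.2 hQ, map_smul, opTT_single (inv_mem I.2) hQ.symm, smul_smul, ← mul_inv,
    ← mul_pow, ← map_mul, ← Units.val_mul, mul_inv_cancel, Units.val_one, map_one, one_pow,
    inv_one, one_smul]

theorem mem_heckePart_of_single {Γ : LevelKind} {c : ClassGroup (𝓞 K)} {T : HeckeAlgebra n Γ}
    (h : ∀ P : ModularPoint n Γ, (T : RatEnd n Γ) (Finsupp.single P 1) ∈ ratPart n Γ (c * P.cls)) :
    T ∈ heckePart n Γ c := by
  intro c' x hx
  rw [ratPart, Finsupp.supported_eq_span_single] at hx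
  refine Submodule.span_induction ?_ ?_ ?_ ?_ hx
  · rintro _ ⟨P, hP, rfl⟩
    have := h P
    rwa [show P.cls = c' from hP] at this
  · rw [map_zero]; exact Submodule.zero_mem _
  · intro x y _ _ hx hy; rw [map_add]; exact Submodule.add_mem _ hx hy
  · intro r x _ hx; rw [map_smul]; exact Submodule.smul_mem _ r hx

/-- No finiteness of `S` is needed: over an infinite set the sum defaults to 0, which lies in the
subspace. -/
theorem finsum_single_mem_ratPart {Γ : LevelKind} {c : ClassGroup (𝓞 K)}
    {S : Set (ModularPoint n Γ)} (h : ∀ Q ∈ S, Q.cls = c) :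
    (∑ᶠ Q ∈ S, (Finsupp.single Q 1 : ModularPoint n Γ →₀ ℚ)) ∈ ratPart n Γ c :=
  finsum_mem_induction (· ∈ ratPart n Γ c) (Submodule.zero_mem _)
    (fun _ _ => Submodule.add_mem _)
    fun Q hQ => Finsupp.single_mem_supported ℚ 1 (h Q hQ)

/-- The inverse appears because `T_𝔞` passes to superlattices `M`, and `[L] = [𝔞][M]`. -/
theorem heckeT_mem_heckePart (n : Ideal (𝓞 K)) (Γ : LevelKind) (I : (Ideal (𝓞 K))⁰) :
    heckeT n Γ I ∈ heckePart n Γ (ClassGroup.mk0 I)⁻¹ := by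
  refine mem_heckePart_of_single fun P => ?_
  change opT n Γ I _ ∈ _
  rw [opT, Finsupp.linearCombination_single, one_smul]
  refine Submodule.smul_mem _ _ (finsum_single_mem_ratPart fun Q hQ => ?_)
  rw [eq_inv_mul_iff_mul_eq]
  exact (steinitzClass_eq P.toPair.isLattice
    ((hasClass_steinitzClass Q.toPair.isLattice).of_hasIndexIdeal hQ.1)).symm

theorem heckeTT_mem_heckePart (n : Ideal (𝓞 K)) (Γ : LevelKind) (I : coprimeIdeals n) :
    heckeTT n Γ I ∈ heckePart n Γ (ClassGroup.mk (K := K) (I : FracIdeals K)⁻¹ ^ 2) := by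
  refine mem_heckePart_of_single fun P => ?_
  change opTT n Γ I _ ∈ _
  rw [opTT, Finsupp.linearCombination_single, one_smul]
  refine Submodule.smul_mem _ _ (finsum_single_mem_ratPart fun Q hQ => ?_)
  refine steinitzClass_eq Q.toPair.isLattice ?_
  rw [hQ.1]
  exact (hasClass_steinitzClass P.toPair.isLattice).fracMul _

end Scaling

/-! ### The subgroup `H₀`, inner twists and components of eigenvectors. -/

section Eigenvectors

variable {K : Type*} [Field K] [NumberField K] {n : Ideal (𝓞 K)} {Γ : LevelKind}

theorem sq_mem_H₀ (hn : n ≠ ⊥) (lam : Eigensystem n Γ) (c : ClassGroup (𝓞 K)) :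
    c ^ 2 ∈ H₀ lam := by
  -- The class `c⁻¹` compensates for the inverse in the class of `T_{𝔞,𝔞}`.
  obtain ⟨A, hA, hAn⟩ := exists_mk0_eq_isCoprime c⁻¹ hn
  let I : coprimeIdeals n := ⟨FractionalIdeal.mk0 K A,
    Subgroup.subset_closure ⟨A, hAn, FractionalIdeal.coe_mk0 K A⟩⟩
  have hI := heckeTT_mem_heckePart n Γ I
  have hc : ClassGroup.mk (K := K) (I : FracIdeals K)⁻¹ = c := by
    rw [map_inv, ClassGroup.mk_mk0, hA, inv_inv]
  rw [hc] at hI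
  refine ⟨_, hI, fun h0 => ?_⟩
  have h1 := congrArg lam (heckeTT_mul_inv n Γ I)
  rw [map_mul, h0, mul_zero, map_one] at h1
  exact zero_ne_one h1

/-- A character separating a missing class from `H₀ lam` is quadratic, since squares lie in `H₀
lam`, and twisting by it fixes `lam`. -/
theorem H₀_eq_top (hn : n ≠ ⊥) (lam : Eigensystem n Γ) (h : ¬ HasInnerTwist lam) :
    H₀ lam = ⊤ := by
  by_contra hne
  obtain ⟨c, hc⟩ := SetLike.exists_not_mem_of_ne_top (H₀ lam) hne
  have hc' : (QuotientGroup.mk c : ClassGroup (𝓞 K) ⧸ H₀ lam) ≠ 1 :=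
    fun h1 => hc ((QuotientGroup.eq_one_iff c).mp h1)
  obtain ⟨φ, hφ⟩ := CommGroup.exists_apply_ne_one_of_hasEnoughRootsOfUnity
    (ClassGroup (𝓞 K) ⧸ H₀ lam) ℂ hc'
  let ψ : ClassGroup (𝓞 K) →* ℂˣ := φ.comp (QuotientGroup.mk' (H₀ lam))
  have htriv : ∀ d ∈ H₀ lam, ψ d = 1 := fun d hd => by
    change φ (QuotientGroup.mk d) = 1
    rw [(QuotientGroup.eq_one_iff d).mpr hd, map_one]
  have hsq : ∀ d, ψ d ^ 2 = 1 := fun d => by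
    rw [← map_pow]; exact htriv _ (sq_mem_H₀ hn lam d)
  refine h ⟨ψ, fun h1 => hφ (DFunLike.congr_fun h1 c), MonoidHom.ext hsq, fun I => ?_, fun I => ?_⟩
  · by_cases h0 : lam (heckeT n Γ I) = 0
    · rw [h0, mul_zero]
    · have hmem : (ClassGroup.mk0 I)⁻¹ ∈ H₀ lam := ⟨_, heckeT_mem_heckePart n Γ I, h0⟩
      rw [htriv _ (inv_mem_iff.mp hmem), Units.val_one, one_mul]
  · rw [← Units.val_pow_eq_pow_val, hsq, Units.val_one, one_mul]

theorem not_hasInnerTwist_of_odd (lam : Eigensystem n Γ) (h : Odd (NumberField.classNumber K)) :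
    ¬ HasInnerTwist lam := by
  rintro ⟨ψ, hψ, hψ2, -⟩
  refine hψ (MonoidHom.ext fun c => ?_)
  have h1 : ψ c ^ 2 = 1 := DFunLike.congr_fun hψ2 c
  have h2 : ψ c ^ NumberField.classNumber K = 1 := by
    rw [← map_pow, NumberField.classNumber, pow_card_eq_one, map_one]
  have h3 := Nat.dvd_gcd (orderOf_dvd_of_pow_eq_one h1) (orderOf_dvd_of_pow_eq_one h2)
  rw [h.coprime_two_left] at h3
  exact orderOf_eq_one_iff.mp (Nat.dvd_one.mp h3)

/-- The conclusions about the components of an eigenvector, from the compatibility of the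
components with the operators that have a class. -/
theorem components_of_eigenvector {V : Type*} [AddCommGroup V] [Module ℂ V] (hn : n ≠ ⊥)
    (lam : Eigensystem n Γ) (v : ClassGroup (𝓞 K) → V) (hv : ∃ c, v c ≠ 0)
    (hT : ∀ h, ∀ T ∈ heckePart n Γ h, ∀ c, v c = 0 → lam T • v (h * c) = 0) :
    (∀ c₁, v c₁ = 0 → ∀ h ∈ H₀ lam, v (h * c₁) = 0) ∧
      (¬ HasInnerTwist lam → ∀ c, v c ≠ 0) ∧
      (Odd (NumberField.classNumber K) → ∀ c, v c ≠ 0) := by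
  have h1 : ∀ c₁, v c₁ = 0 → ∀ h ∈ H₀ lam, v (h * c₁) = 0 := by
    rintro c₁ hc h ⟨T, hTh, hT0⟩
    exact (smul_eq_zero.mp (hT h T hTh c₁ hc)).resolve_left hT0
  have h2 : ¬ HasInnerTwist lam → ∀ c, v c ≠ 0 := by
    intro hlam c hc
    obtain ⟨d, hd⟩ := hv
    refine hd ?_
    have := h1 c hc (d * c⁻¹) (by rw [H₀_eq_top hn lam hlam]; exact Subgroup.mem_top _)
    rwa [inv_mul_cancel_right] at this
  exact ⟨h1, h2, fun hodd => h2 (not_hasInnerTwist_of_odd lam hodd)⟩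

theorem component_single_of_eq {c : ClassGroup (𝓞 K)} {P : ModularPoint n Γ} (h : P.cls = c)
    (a : ℂ) : component c (Finsupp.single P a) = Finsupp.single P a := by
  classical
  exact Finsupp.filter_single_of_pos _ h

theorem component_single_of_ne {c : ClassGroup (𝓞 K)} {P : ModularPoint n Γ} (h : P.cls ≠ c)
    (a : ℂ) : component c (Finsupp.single P a) = 0 := by
  classical
  exact Finsupp.filter_single_of_neg _ h

theorem component_add (c : ClassGroup (𝓞 K)) (v w : ModularPoint n Γ →₀ ℂ) :
    component c (v + w) = component c v + component c w := by
  classical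
  exact Finsupp.filter_add

theorem component_complexify {h : ClassGroup (𝓞 K)} {T : HeckeAlgebra n Γ}
    (hT : T ∈ heckePart n Γ h) (c : ClassGroup (𝓞 K)) (v : ModularPoint n Γ →₀ ℂ) :
    component (h * c) (complexify (T : RatEnd n Γ) v) =
      complexify (T : RatEnd n Γ) (component c v) := by
  classical
  induction v using Finsupp.induction_linear with
  | zero =>
    have h0 : ∀ d : ClassGroup (𝓞 K), component d (0 : ModularPoint n Γ →₀ ℂ) = 0 := fun d =>
      Finsupp.filter_zero _
    rw [map_zero, h0, h0, map_zero]
  | add v w hv hw => rw [map_add, component_add, hv, hw, component_add, map_add]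
  | single P a =>
    have hsupp : ∀ Q, (complexify (T : RatEnd n Γ) (Finsupp.single P a)) Q ≠ 0 →
        Q.cls = h * P.cls := by
      intro Q hQ
      have hmem := hT P.cls (Finsupp.single P 1) (Finsupp.single_mem_supported ℚ 1 rfl)
      refine hmem (Finsupp.mem_support_iff.mpr fun h0 => hQ ?_)
      rw [complexify, Finsupp.linearCombination_single, Finsupp.smul_apply,
        Finsupp.mapRange_apply, h0, Rat.cast_zero, smul_zero]
    by_cases hP : P.cls = c
    · rw [component_single_of_eq hP, component, Finsupp.filter_eq_self_iff]
      intro Q hQ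
      rw [hsupp Q hQ, hP]
    · rw [component_single_of_ne hP, map_zero, component, Finsupp.filter_eq_zero_iff]
      intro Q hQ
      by_contra h0
      exact hP (mul_left_cancel ((hsupp Q h0).symm.trans hQ))

theorem exists_component_ne_zero {v : ModularPoint n Γ →₀ ℂ} (hv : v ≠ 0) :
    ∃ c : ClassGroup (𝓞 K), component c v ≠ 0 := by
  classical
  obtain ⟨P, hP⟩ := Finsupp.ne_iff.mp hv
  refine ⟨P.cls, fun h0 => hP ?_⟩
  have := DFunLike.congr_fun h0 P
  rwa [component,
    Finsupp.filter_apply_pos (fun Q : ModularPoint n Γ => Q.cls = P.cls) v rfl] at this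

theorem component_smul (c : ClassGroup (𝓞 K)) (a : ℂ) (v : ModularPoint n Γ →₀ ℂ) :
    component c (a • v) = a • component c v := by
  classical
  exact Finsupp.filter_smul

/-- After reindexing by `d = h * c`, the eigenvector equation is a vanishing sum of terms in the `W
d`, and independence kills each term. -/
theorem IsClassGraded.apply_component {V : Type*} [AddCommGroup V] [Module ℂ V]
    {ρ : HeckeAlgebra n Γ →+* Module.End ℂ V} {W : ClassGroup (𝓞 K) → Submodule ℂ V}
    (hW : IsClassGraded ρ W) {v : ClassGroup (𝓞 K) → V} (hv : ∀ c, v c ∈ W c)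
    {h : ClassGroup (𝓞 K)} {T : HeckeAlgebra n Γ} (hT : T ∈ heckePart n Γ h) {a : ℂ}
    (heig : ρ T (∑ c, v c) = a • ∑ c, v c) (c : ClassGroup (𝓞 K)) :
    ρ T (v c) = a • v (h * c) := by
  have hsum : ∑ d, (ρ T (v (h⁻¹ * d)) - a • v d) = 0 := by
    rw [Finset.sum_sub_distrib, ← Finset.smul_sum, ← heig, map_sum, sub_eq_zero]
    exact Fintype.sum_equiv (Equiv.mulLeft h⁻¹) _ _ fun d => rfl
  have hmem : ∀ d, ρ T (v (h⁻¹ * d)) - a • v d ∈ W d := by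
    intro d
    have := hW.map_mem h (h⁻¹ * d) T hT _ (hv _)
    rw [mul_inv_cancel_left] at this
    exact Submodule.sub_mem _ this (Submodule.smul_mem _ _ (hv d))
  have h0 := (iSupIndep_iff_finsetSum_eq_zero_imp_eq_zero W).mp hW.indep Finset.univ _
    (fun d _ => hmem d) hsum (h * c) (Finset.mem_univ _)
  rwa [inv_mul_cancel_left, sub_eq_zero] at h0

end Eigenvectors

end HeckePoints

end

open HeckePoints NumberField in
theorem mainTheorem9 {K : Type*} [Field K] [NumberField K] (n : Ideal (𝓞 K)) (hn : n ≠ ⊥)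
    (Γ : LevelKind) (lam : Eigensystem n Γ) :
    -- eigenvectors in the space spanned by the modular points
    (∀ v : ModularPoint n Γ →₀ ℂ, IsEigenvector lam v →
      (∀ c₁ : ClassGroup (𝓞 K), component c₁ v = 0 →
        ∀ h ∈ H₀ lam, component (h * c₁) v = 0) ∧
      (¬ HasInnerTwist lam → ∀ c : ClassGroup (𝓞 K), component c v ≠ 0) ∧
      (Odd (classNumber K) → ∀ c : ClassGroup (𝓞 K), component c v ≠ 0)) ∧
    -- eigenvectors in an arbitrary graded representation of the Hecke algebra
    (∀ (V : Type*) [AddCommGroup V] [Module ℂ V] (ρ : HeckeAlgebra n Γ →+* Module.End ℂ V)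
      (W : ClassGroup (𝓞 K) → Submodule ℂ V), IsClassGraded ρ W →
      ∀ v : ClassGroup (𝓞 K) → V, (∀ c, v c ∈ W c) → ∑ c, v c ≠ 0 →
      (∀ T : HeckeAlgebra n Γ, ρ T (∑ c, v c) = lam T • ∑ c, v c) →
      (∀ c₁ : ClassGroup (𝓞 K), v c₁ = 0 → ∀ h ∈ H₀ lam, v (h * c₁) = 0) ∧
      (¬ HasInnerTwist lam → ∀ c : ClassGroup (𝓞 K), v c ≠ 0) ∧
      (Odd (classNumber K) → ∀ c : ClassGroup (𝓞 K), v c ≠ 0)) ∧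
    -- the case of odd class number
    (Odd (classNumber K) → ¬ HasInnerTwist lam) := by
  refine ⟨fun v hv => ?_, fun V _ _ ρ W hW v hvW hv0 hv => ?_, not_hasInnerTwist_of_odd lam⟩
  · refine components_of_eigenvector hn lam (fun c => component c v)
      (exists_component_ne_zero hv.1) fun h T hT c hc => ?_
    have := component_complexify hT c v
    rwa [hc, map_zero, hv.2 T, component_smul] at this
  · refine components_of_eigenvector hn lam v ?_ fun h T hT c hc => ?_
    · by_contra! h0
      exact hv0 (Finset.sum_eq_zero fun c _ => h0 c)
    · rw [← hW.apply_component hvW hT (hv T), hc, map_zero]
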